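/- **Definitions.** For $0<\lambda<1$ put $u=8\lambda^2-8\lambda+1$ and \[h(\lambda)=\begin{cases} \dfrac{2\arctan\left(\sqrt{-u}/|1-2\lambda|\right)}{\sqrt{-u}}&\text{if }u<0,\\ 2\sqrt2&\text{if }u=0,\\ \dfrac{2\,\mathrm{artanh}\left(\sqrt{u}/|1-2\lambda|\right)}{\sqrt{u}}&\text{if }u>0, \end{cases}\] where $h(1/2)=\pi$ (that is, $\arctan(1/0)=\pi/2$), and let $C_1=\inf_{0<\lambda<1}h(\lambda)$ (at $\lambda=0,1$ one has $h=+\infty$). Let $X,Y$ be formal noncommuting variables. For $p,q\ge 0$ let $z_{p,q}$ be the part of $\log(\exp(X)\exp(Y))$ of degree $p$ in $X$ and $q$ in $Y$, and let $z^{\mathrm{Lie}}_{p,q}$ be the element of the free Lie algebra on $X,Y$ whose commutator expansion in the free associative algebra is $z_{p,q}$. Let $\Gamma^{\mathrm{Lie}}_{p,q}\in[0,\infty]$ be the infimum of $\sum_\gamma|\theta_\gamma|$ over all presentations $z^{\mathrm{Lie}}_{p,q}=\sum_\gamma\theta_\gamma\gamma$ of $z^{\mathrm{Lie}}_{p,q}$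 as a finite real linear combination of Lie monomials $\gamma$ (iterated brackets of the variables) of degree $p$ in $X$ and $q$ in $Y$. The absolute BCH characteristic is \[\Gamma^{\mathrm{Lie}}(x,y)=\sum_{p,q\ge0}\Gamma^{\mathrm{Lie}}_{p,q}\,x^py^q .\] A Banach--Lie algebra is a real or complex Banach space $\mathfrak g$ with a Lie algebra structure over its scalar field such that $\|[X,Y]\|\le\|X\|\cdot\|Y\|$ for all $X,Y\in\mathfrak g$. **Theorem.** One has $C_1=2.7014\ldots$, i.e. $2.7014\le C_1<2.7015$. (1) If $x,y\in\mathbb C$ and $|x|+|y|<C_1$, then all $\Gamma^{\mathrm{Lie}}_{p,q}$ are finite, $\Gamma^{\mathrm{Lie}}(|x|,|y|)<\infty$, and the series $\Gamma^{\mathrm{Lie}}(x,y)$ converges absolutely. (2) Over $\mathbb R$ and over $\mathbb C$, for all $p,q$ there is exactly one Lie polynomial $z^{\mathrm{Lie}}_{p,q}$ as above. If $X,Y$ are elements of a Banach--Lie algebra with $\|X\|+\|Y\|<C_1$, then the Baker--Campbell--Hausdorff expansion of the pair $X,Y$ converges absolutely: \[\sum_{p,q\ge0}\bigl\|z^{\mathrm{Lie}}_{p,q}(X,Y)\bigr\|<\infty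 \qquad\text{and}\qquad \sum_{n\ge0}\Bigl\|\sum_{p+q=n}z^{\mathrm{Lie}}_{p,q}(X,Y)\Bigr\|<\infty .\] -/

import Mathlib

open scoped NNReal ENNReal Nat

/-- A Lie ring with a norm satisfying `‖⁅X, Y⁆‖ ≤ ‖X‖ * ‖Y‖`. -/
class NormedLieRing (𝔤 : Type*) extends NormedAddCommGroup 𝔤, LieRing 𝔤 where
  norm_lie_le : ∀ X Y : 𝔤, ‖⁅X, Y⁆‖ ≤ ‖X‖ * ‖Y‖

/-- A normed Lie algebra over `𝕜`; a Banach-Lie algebra is a complete one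
(that is, one with `[CompleteSpace 𝔤]`). -/
class NormedLieAlgebra (𝕜 : Type*) (𝔤 : Type*) [RCLike 𝕜] [NormedLieRing 𝔤]
    extends NormedSpace 𝕜 𝔤, LieAlgebra 𝕜 𝔤

namespace BCH

noncomputable section

section Formal

variable (K : Type*) [Field K]

/-- The formal variable `X` of the free associative algebra on two generators. -/
def varX : FreeAlgebra K (Fin 2) := FreeAlgebra.ι K 0

/-- The formal variable `Y` of the free associative algebra on two generators. -/
def varY : FreeAlgebra K (Fin 2) := FreeAlgebra.ι K 1

/-- The formal series `exp(sX)`, as a power series in two central variables `s` (index `0`) and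
`t` (index `1`) with coefficients in the free associative algebra on `X`, `Y`. -/
def expX : MvPowerSeries (Fin 2) (FreeAlgebra K (Fin 2)) :=
  fun m => if m 1 = 0 then (((m 0)! : ℕ) : K)⁻¹ • varX K ^ m 0 else 0

/-- The formal series `exp(tY)`. -/
def expY : MvPowerSeries (Fin 2) (FreeAlgebra K (Fin 2)) :=
  fun m => if m 0 = 0 then (((m 1)! : ℕ) : K)⁻¹ • varY K ^ m 1 else 0

/-- The exponent of the monomial `s ^ p * t ^ q`. -/
def expo (p q : ℕ) : Fin 2 →₀ ℕ := Finsupp.single 0 p + Finsupp.single 1 q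

/-- The part of `log(exp X * exp Y)` of degree `p` in `X` and degree `q` in `Y`, i.e. the
coefficient of `s ^ p * t ^ q` in `log(exp(sX) * exp(tY))`, where `log(1 + U)` is
`∑_{k ≥ 1} (-1) ^ (k + 1) / k * U ^ k`. As `U = exp(sX) * exp(tY) - 1` has no constant term,
only the powers with `k ≤ p + q` contribute. -/
def bchAssoc (p q : ℕ) : FreeAlgebra K (Fin 2) :=
  ∑ k ∈ Finset.Icc 1 (p + q),
    ((-1 : K) ^ (k + 1) / (k : K)) •
      MvPowerSeries.coeff (expo p q) ((expX K * expY K - 1) ^ k)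

section

attribute [local instance] LieRing.ofAssociativeRing

/-- The canonical map from Lie polynomials in `X`, `Y` to noncommutative polynomials in `X`, `Y`,
which reads a Lie bracket as the commutator. -/
def lieToAssoc : FreeLieAlgebra K (Fin 2) →ₗ[K] FreeAlgebra K (Fin 2) :=
  (FreeLieAlgebra.lift K (FreeAlgebra.ι K) :
    FreeLieAlgebra K (Fin 2) →ₗ⁅K⁆ FreeAlgebra K (Fin 2)).toLinearMap

end

/-- The Lie polynomial whose commutator expansion is the part of bidegree `(p, q)` of
`log(exp X * exp Y)`. (That it exists and is unique is part of the main statement.) -/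
def bchLie (p q : ℕ) : FreeLieAlgebra K (Fin 2) :=
  Classical.epsilon fun P => lieToAssoc K P = bchAssoc K p q

end Formal

/-- The Lie monomial in `X`, `Y` (an iterated bracket of the variables) with a given
bracketing. -/
def lieMonomial : FreeMagma (Fin 2) → FreeLieAlgebra ℝ (Fin 2)
  | .of i => FreeLieAlgebra.of ℝ i
  | .mul a b => ⁅lieMonomial a, lieMonomial b⁆

/-- The multiplicity of the variable `i` in a bracketed monomial. -/
def degIn (i : Fin 2) : FreeMagma (Fin 2) → ℕ
  | .of j => if j = i then 1 else 0
  | .mul a b => degIn i a + degIn i b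

/-- `θ` gives a presentation of the bidegree `(p, q)` part of the BCH series as a real linear
combination of Lie monomials of degree `p` in `X` and degree `q` in `Y`. -/
def IsPresentation (p q : ℕ) (θ : FreeMagma (Fin 2) →₀ ℝ) : Prop :=
  (∀ γ ∈ θ.support, degIn 0 γ = p ∧ degIn 1 γ = q) ∧
    (θ.sum fun γ c => c • lieMonomial γ) = bchLie ℝ p q

/-- The minimal sum of the absolute values of the coefficients in presentations of the bidegree
`(p, q)` part of the BCH series by Lie monomials (`∞` if there were no presentation). -/
def gammaCoeff (p q : ℕ) : ℝ≥0∞ :=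
  ⨅ (θ : FreeMagma (Fin 2) →₀ ℝ) (_ : IsPresentation p q θ),
    θ.sum fun _ c => ENNReal.ofReal |c|

/-- The absolute BCH characteristic `Γ^Lie(x, y)` for `x, y ≥ 0`, with values in `[0, ∞]`. -/
def gammaLie (x y : ℝ≥0) : ℝ≥0∞ :=
  ∑' pq : ℕ × ℕ, gammaCoeff pq.1 pq.2 * (x : ℝ≥0∞) ^ pq.1 * (y : ℝ≥0∞) ^ pq.2

section Evaluation

variable (𝕜 : Type*) {𝔤 : Type*} [RCLike 𝕜] [NormedLieRing 𝔤] [NormedLieAlgebra 𝕜 𝔤]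

/-- The value at `X, Y ∈ 𝔤` of the bidegree `(p, q)` part of the BCH series. -/
def bchPart (X Y : 𝔤) (p q : ℕ) : 𝔤 :=
  FreeLieAlgebra.lift 𝕜 ![X, Y] (bchLie 𝕜 p q)

/-- The value at `X, Y ∈ 𝔤` of the homogeneous part of degree `n` of the BCH series. -/
def bchTerm (X Y : 𝔤) (n : ℕ) : 𝔤 :=
  ∑ pq ∈ Finset.HasAntidiagonal.antidiagonal n, bchPart 𝕜 X Y pq.1 pq.2

end Evaluation

/-- The function `h` on `(0, 1)`. At `l = 1/2` the quotient inside `arctan` is `1/0`, to be read as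
`+∞`, so that the value is `2 * (π / 2) / 1 = π`. -/
def h (l : ℝ) : ℝ :=
  let u := 8 * l ^ 2 - 8 * l + 1
  if l = 1 / 2 then Real.pi
  else if u < 0 then 2 * Real.arctan (√(-u) / |1 - 2 * l|) / √(-u)
  else if u = 0 then 2 * √2
  else 2 * Real.artanh (√u / |1 - 2 * l|) / √u

/-- `C₁ = min h`. The endpoints `0` and `1`, where `h = 2 * artanh 1 = +∞`, are left out. -/
def C₁ : ℝ := sInf (h '' Set.Ioo 0 1)

end

end BCH

/-! Put `U = exp X * exp Y - 1`. Then `log (1 + U)` is the integral over `0 ≤ s ≤ 1` of `U (1 +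
sU)⁻¹`, so it suffices to bound the coefficient sums of this resolvent uniformly in `s`. Let `a =
(exp X - 1) / (1 - s + s exp X)` and let `b` be the same series in `Y`. The identity `(1 - s a)(1 +
s U)(1 - s b) = 1 + s (1 - s) a b` (`conj_expProd`) reduces the resolvent to a geometric series in
the alternating product `a b`.

The series `a` solves the Riccati equation `a' = 1 + (1 - 2s) a - s (1 - s) a²`. Taking absolute
values of coefficients gives a subsolution of `r' = 1 + d r + (1 - d²)/4 r²` with `d = |1 - 2s|`,
whose solution is `r = S/D` with `S = sSol (2d² - 1)` and `D = riccatiDen d`. The addition formula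
`D(x+y) = D(x) D(y) (1 - s (1 - s) r(x) r(y))` shows that the geometric series at `(x, y)` converges
as long as `D(x+y) > 0`. For `0 < s < 1` the first positive zero of `D` is `h s`, so `x + y < C₁`
handles all `s` at once, and compactness of the parameter interval makes the bound uniform
(`exists_bound`, `exists_truncNorm_resolvent_le`). Integration over `s` yields
`exists_sum_l1Norm_bchAssoc_le`.

To pass from words to brackets, the Dynkin map sends a word to its right-nested bracket, and the
Dynkin-Specht-Wever formula `dynkinAssoc_bchAssoc` says that on the part of degree `n` of the BCH
series it acts as multiplication by `n`. With `lieToAssoc_injective` this gives existence,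
uniqueness and the formula `bchLie_eq`. Each word contributes one Lie monomial, with its coefficient
divided by `n`, so the associative estimate bounds both `gammaCoeff` and the norms in a normed Lie
algebra. The decimals of `C₁` come from the sign of `D` near its first zero, computed with truncated
power series. -/

namespace BCH
noncomputable section

/-! ### The Dynkin map and injectivity of the commutator expansion. -/

section FreeLie

attribute [local instance] LieRing.ofAssociativeRing

variable (K : Type*) [Field K]

/-- The augmentation of the free associative algebra. -/
def aug : FreeAlgebra K (Fin 2) →ₐ[K] K := FreeAlgebra.lift K fun _ => 0

@[simp] theorem aug_ι (i : Fin 2) : aug K (FreeAlgebra.ι K i) = 0 := by simp [aug]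

/-- The action of the free associative algebra on the free Lie algebra which extends the adjoint
action. -/
def adLie : FreeAlgebra K (Fin 2) →ₐ[K] Module.End K (FreeLieAlgebra K (Fin 2)) :=
  FreeAlgebra.lift K fun i => (LieAlgebra.ad K (FreeLieAlgebra K (Fin 2)) (FreeLieAlgebra.of K i))

/-- The operator `(c, P) ↦ (0, ⁅x, P⁆ + c x)` for a variable `x`. -/
def dynkinStep (i : Fin 2) : Module.End K (K × FreeLieAlgebra K (Fin 2)) :=
  (LinearMap.inr K K (FreeLieAlgebra K (Fin 2))).comp
    ((LieAlgebra.ad K (FreeLieAlgebra K (Fin 2)) (FreeLieAlgebra.of K i)).comp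
        (LinearMap.snd K K _) +
      (LinearMap.toSpanSingleton K _ (FreeLieAlgebra.of K i)).comp (LinearMap.fst K K _))

theorem dynkinStep_apply (i : Fin 2) (c : K) (P : FreeLieAlgebra K (Fin 2)) :
    dynkinStep K i (c, P) = (0, ⁅FreeLieAlgebra.of K i, P⁆ + c • FreeLieAlgebra.of K i) := by
  simp [dynkinStep]

/-- The action of the free associative algebra whose value at `(1, 0)` gives `dynkin`. -/
def dynkinAct : FreeAlgebra K (Fin 2) →ₐ[K] Module.End K (K × FreeLieAlgebra K (Fin 2)) :=
  FreeAlgebra.lift K (dynkinStep K)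

/-- The Dynkin map, sending a word `x₁ ⋯ xₙ` to `⁅x₁, ⁅x₂, …⁆⁆`. -/
def dynkin : FreeAlgebra K (Fin 2) →ₗ[K] FreeLieAlgebra K (Fin 2) :=
  (LinearMap.snd K K _).comp ((LinearMap.applyₗ (1, 0)).comp (dynkinAct K).toLinearMap)

theorem dynkin_apply (u : FreeAlgebra K (Fin 2)) : dynkin K u = (dynkinAct K u (1, 0)).2 := rfl

/-- The representation is block triangular: `aug` and `adLie` are its diagonal blocks and `dynkin`
is the off-diagonal one. Multiplicativity of the whole turns into the cocycle identity `dynkin_mul`.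
-/
theorem dynkinAct_apply (u : FreeAlgebra K (Fin 2)) :
    ∀ (c : K) (P : FreeLieAlgebra K (Fin 2)),
      dynkinAct K u (c, P) = (aug K u * c, adLie K u P + c • dynkin K u) := by
  induction u using FreeAlgebra.induction with
  | grade0 r =>
    intro c P
    simp [dynkin_apply, AlgHom.commutes, Module.algebraMap_end_apply]
  | grade1 i =>
    intro c P
    simp [dynkin_apply, dynkinAct, adLie, dynkinStep_apply]
  | mul a b ha hb =>
    intro c P
    have h1 : dynkin K (a * b) = adLie K a (dynkin K b) + aug K b • dynkin K a := by
      rw [dynkin_apply, map_mul, Module.End.mul_apply, hb, ha]; simp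
    rw [map_mul, Module.End.mul_apply, hb, ha, h1]
    simp [smul_smul, mul_comm, add_assoc]
    ring
  | add a b ha hb =>
    intro c P
    have h1 : dynkin K (a + b) = dynkin K a + dynkin K b := map_add _ _ _
    rw [map_add, LinearMap.add_apply, ha, hb, h1]
    simp only [map_add, Prod.mk_add_mk, LinearMap.add_apply, smul_add, add_mul]
    congr 1; abel

theorem dynkin_mul (a b : FreeAlgebra K (Fin 2)) :
    dynkin K (a * b) = adLie K a (dynkin K b) + aug K b • dynkin K a := by
  rw [dynkin_apply, map_mul, Module.End.mul_apply, dynkinAct_apply K b, dynkinAct_apply K a]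
  simp

theorem dynkin_one : dynkin K 1 = 0 := by simp [dynkin_apply]

theorem dynkin_ι (i : Fin 2) : dynkin K (FreeAlgebra.ι K i) = FreeLieAlgebra.of K i := by
  simp [dynkin_apply, dynkinAct, dynkinStep_apply]

theorem dynkin_ι_mul (i : Fin 2) (v : FreeAlgebra K (Fin 2)) :
    dynkin K (FreeAlgebra.ι K i * v) =
      ⁅FreeLieAlgebra.of K i, dynkin K v⁆ + aug K v • FreeLieAlgebra.of K i := by
  rw [dynkin_mul, dynkin_ι]; simp [adLie]

theorem lieToAssoc_of (i : Fin 2) :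
    lieToAssoc K (FreeLieAlgebra.of K i) = FreeAlgebra.ι K i := by
  simp [lieToAssoc]

theorem lieToAssoc_lie (P Q : FreeLieAlgebra K (Fin 2)) :
    lieToAssoc K ⁅P, Q⁆ =
      lieToAssoc K P * lieToAssoc K Q - lieToAssoc K Q * lieToAssoc K P := by
  simp [lieToAssoc, LieRing.of_associative_ring_bracket]

theorem adLie_lieToAssoc (P : FreeLieAlgebra K (Fin 2)) :
    adLie K (lieToAssoc K P) = LieAlgebra.ad K _ P := by
  have : ((adLie K : FreeAlgebra K (Fin 2) →ₐ[K] _) :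
        FreeAlgebra K (Fin 2) →ₗ⁅K⁆ Module.End K (FreeLieAlgebra K (Fin 2))).comp
      (FreeLieAlgebra.lift K (FreeAlgebra.ι K)) = LieAlgebra.ad K _ := by
    apply FreeLieAlgebra.hom_ext
    intro x
    simp [adLie]
  exact congrArg (fun f => f P) this

theorem aug_lieToAssoc (P : FreeLieAlgebra K (Fin 2)) : aug K (lieToAssoc K P) = 0 := by
  have : ((aug K : FreeAlgebra K (Fin 2) →ₐ[K] _) : FreeAlgebra K (Fin 2) →ₗ⁅K⁆ K).comp
      (FreeLieAlgebra.lift K (FreeAlgebra.ι K)) = 0 := by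
    apply FreeLieAlgebra.hom_ext
    intro x
    simp [aug]
  exact congrArg (fun f => f P) this

/-- The degree operator on the free Lie algebra. -/
def lieEuler : Module.End K (FreeLieAlgebra K (Fin 2)) := (dynkin K).comp (lieToAssoc K)

theorem lieEuler_of (i : Fin 2) :
    lieEuler K (FreeLieAlgebra.of K i) = FreeLieAlgebra.of K i := by
  simp [lieEuler, lieToAssoc_of, dynkin_ι]

/-- On the image of a Lie polynomial the augmentation vanishes and `adLie` is the adjoint action, so
the cocycle identity for `dynkin` becomes the Leibniz rule. -/
theorem lieEuler_lie (P Q : FreeLieAlgebra K (Fin 2)) :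
    lieEuler K ⁅P, Q⁆ = ⁅lieEuler K P, Q⁆ + ⁅P, lieEuler K Q⁆ := by
  simp only [lieEuler, LinearMap.comp_apply, lieToAssoc_lie, map_sub, dynkin_mul, aug_lieToAssoc,
    adLie_lieToAssoc, zero_smul, add_zero, LieAlgebra.ad_apply]
  rw [← lie_skew (dynkin K (lieToAssoc K P)) Q]
  abel

/-- The span of the eigenvectors of the degree operator with positive integral eigenvalues, as a
Lie subalgebra. -/
def posEigen : LieSubalgebra K (FreeLieAlgebra K (Fin 2)) where
  toSubmodule := ⨆ n : ℕ, (lieEuler K).eigenspace ((n + 1 : ℕ) : K)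
  lie_mem' := by
    intro P Q hP hQ
    simp only [Submodule.mem_carrier] at *
    refine Submodule.iSup_induction _ (motive := fun P => ⁅P, Q⁆ ∈
      ⨆ n : ℕ, (lieEuler K).eigenspace ((n + 1 : ℕ) : K)) hP ?_ (by simp)
      (fun a b ha hb => by rw [add_lie]; exact add_mem ha hb)
    intro n P hP
    refine Submodule.iSup_induction _ (motive := fun Q => ⁅P, Q⁆ ∈
      ⨆ n : ℕ, (lieEuler K).eigenspace ((n + 1 : ℕ) : K)) hQ ?_ (by simp)
      (fun a b ha hb => by rw [lie_add]; exact add_mem ha hb)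
    intro m Q hQ
    refine Submodule.mem_iSup_of_mem (n + m + 1) ?_
    rw [Module.End.mem_eigenspace_iff] at *
    rw [lieEuler_lie, hP, hQ, smul_lie, lie_smul, ← add_smul]
    congr 1; push_cast; ring

/-- A Lie subalgebra containing the generators is everything: lifting the generators into it and
including back gives the identity. -/
theorem mem_posEigen (P : FreeLieAlgebra K (Fin 2)) : P ∈ posEigen K := by
  have hof : ∀ i, FreeLieAlgebra.of K i ∈ posEigen K := fun i => by
    change _ ∈ ⨆ n : ℕ, (lieEuler K).eigenspace ((n + 1 : ℕ) : K)
    refine Submodule.mem_iSup_of_mem 0 ?_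
    rw [Module.End.mem_eigenspace_iff, lieEuler_of]; simp
  have : (posEigen K).incl.comp (FreeLieAlgebra.lift K fun i => ⟨FreeLieAlgebra.of K i, hof i⟩) =
      LieHom.id := by
    apply FreeLieAlgebra.hom_ext
    intro x
    simp
  have h2 := congrArg (fun f => f P) this
  simp only [LieHom.comp_apply, LieHom.id_apply] at h2
  rw [← h2]
  exact Subtype.property _

/-- `lieEuler` factors through `lieToAssoc`, so the kernel lies in its `0`-eigenspace. The free Lie
algebra is spanned by eigenspaces for positive integers, which are nonzero in characteristic zero,
and eigenspaces are independent. -/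
theorem lieToAssoc_injective [CharZero K] : Function.Injective (lieToAssoc K) := by
  rw [injective_iff_map_eq_zero]
  intro P hP
  have h0 : P ∈ (lieEuler K).eigenspace 0 := by
    rw [Module.End.mem_eigenspace_iff]; simp [lieEuler, hP]
  have h1 : P ∈ ⨆ n : ℕ, (lieEuler K).eigenspace ((n + 1 : ℕ) : K) := mem_posEigen K P
  have hle : (⨆ n : ℕ, (lieEuler K).eigenspace ((n + 1 : ℕ) : K)) ≤
      ⨆ (a : K) (_ : a ≠ 0), (lieEuler K).eigenspace a :=
    iSup_le fun n => le_iSup₂_of_le ((n + 1 : ℕ) : K) (by exact_mod_cast Nat.succ_ne_zero n) le_rfl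
  have := (Module.End.eigenspaces_iSupIndep (lieEuler K)) 0
  exact (Submodule.disjoint_def.mp this) P h0 (hle h1)

end FreeLie

end
end BCH


/-! ### The truncated identity `log ((1 + v)(1 + c)) = log (1 + v) + log (1 + c)` in commuting
variables. -/

namespace BCH
noncomputable section

section LogIdentity

open MvPolynomial

variable (K : Type*) [Field K]

theorem geom_sum_sub_geom_sum {R : Type*} [CommRing R] (v c : R) (N : ℕ) :
    (∑ k ∈ Finset.range N, (-(v + c + v * c)) ^ k) * (1 + v) - ∑ k ∈ Finset.range N, (-c) ^ k =
      (-1) ^ (N + 1) * (v * ∑ i ∈ Finset.range N, (v + c + v * c) ^ i * c ^ (N - 1 - i)) := by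
  induction N with
  | zero => simp
  | succ N ih =>
    rw [Finset.sum_range_succ, Finset.sum_range_succ, Nat.add_sub_cancel, geom_sum₂_succ_eq]
    have h := geom_sum₂_mul (v + c + v * c) c N
    rw [neg_pow (v + c + v * c) N, neg_pow c N]
    linear_combination ih - (-1) ^ N * h

/-- The truncated logarithmic series, in divided form; `v`, `c` are two commuting variables, and
`1 + u = (1 + v) * (1 + c)`. -/
def logDefect {R : Type*} [Ring R] [Algebra K R] (v c : R) (N : ℕ) : R :=
  ∑ k ∈ Finset.Icc 1 N, ((-1 : K) ^ (k + 1) / (k : K)) •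
    ((∑ i ∈ Finset.range k, (v + c + v * c) ^ i * v ^ (k - 1 - i)) * (1 + v) - c ^ (k - 1))

/-- With `u = v + c + v c` one has `u - v = c (1 + v)`, so `u ^ k - v ^ k` is divisible by `c`;
`logDefect` is the quotient by `c` of the defect in the additivity of the truncated logarithm. -/
theorem mul_logDefect {R : Type*} [CommRing R] [Algebra K R] (v c : R) (N : ℕ) :
    c * logDefect K v c N = ∑ k ∈ Finset.Icc 1 N, ((-1 : K) ^ (k + 1) / (k : K)) •
      ((v + c + v * c) ^ k - v ^ k - c ^ k) := by
  rw [logDefect, Finset.mul_sum]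
  refine Finset.sum_congr rfl fun k hk => ?_
  rw [mul_smul_comm]
  congr 1
  obtain ⟨k, rfl⟩ : ∃ j, k = j + 1 := ⟨k - 1, by have := (Finset.mem_Icc.mp hk).1; omega⟩
  have h := geom_sum₂_mul (v + c + v * c) v (k + 1)
  simp only [Nat.add_sub_cancel] at h ⊢
  linear_combination h

/-- Differentiation in `c` removes the denominators `k` and leaves two geometric sums, whose
difference consists of terms of degree at least `N`. -/
theorem pderiv_mul_logDefect [CharZero K] (N : ℕ) :
    pderiv 1 ((X 1 : MvPolynomial (Fin 2) K) * logDefect K (X 0) (X 1) N) =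
      (-1) ^ (N + 1) * (X 0 * ∑ i ∈ Finset.range N,
        (X 0 + X 1 + X 0 * X 1) ^ i * X 1 ^ (N - 1 - i)) := by
  rw [← geom_sum_sub_geom_sum, mul_logDefect, map_sum, Finset.sum_mul, ← Finset.sum_sub_distrib,
    Finset.range_eq_Ico, ← Finset.Ico_add_one_right_eq_Icc, Finset.sum_Ico_eq_sum_range,
    ← Finset.range_eq_Ico]
  refine Finset.sum_congr (by simp) fun k _ => ?_
  rw [Derivation.map_smul, show 1 + k = k + 1 by ring]
  have h01 : pderiv 1 (X 0 : MvPolynomial (Fin 2) K) = 0 := pderiv_X_of_ne (by decide)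
  simp only [map_sub, Derivation.leibniz_pow, map_add, Derivation.leibniz, pderiv_X_self, h01,
    zero_add, smul_eq_mul, mul_one, Nat.add_sub_cancel, nsmul_eq_mul]
  have hk : ((k + 1 : ℕ) : K) ≠ 0 := by exact_mod_cast Nat.succ_ne_zero k
  have h2 : ((-1 : K) ^ (k + 1 + 1) / ((k + 1 : ℕ) : K)) * ((k + 1 : ℕ) : K) = (-1) ^ k := by
    rw [div_mul_cancel₀ _ hk, pow_add, pow_add]; ring
  have h3 : C ((-1 : K) ^ (k + 1 + 1) / ((k + 1 : ℕ) : K)) * ((k + 1 : ℕ) : MvPolynomial (Fin 2) K)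
      = (-1) ^ k := by
    rw [← map_natCast (C : K →+* MvPolynomial (Fin 2) K), ← map_mul, h2]; simp
  rw [smul_eq_C_mul, neg_pow (X 0 + X 1 + X 0 * X 1 : MvPolynomial (Fin 2) K) k,
    neg_pow (X 1 : MvPolynomial (Fin 2) K) k]
  linear_combination
    ((X 0 + X 1 + X 0 * X 1) ^ k * (1 + X 0) - X 1 ^ k : MvPolynomial (Fin 2) K) * h3

/-- Multiplying by `c` and differentiating in `c` scales the coefficient at `m` by `m 1 + 1`, which
is invertible, so the vanishing can be read off from the derivative. -/
theorem coeff_logDefect [CharZero K] (N : ℕ) (m : Fin 2 →₀ ℕ) (hm : m.degree < N) :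
    coeff m (logDefect K (X 0 : MvPolynomial (Fin 2) K) (X 1) N) = 0 := by
  have h1 : coeff (m + Finsupp.single 1 1)
      ((X 1 : MvPolynomial (Fin 2) K) * logDefect K (X 0) (X 1) N) =
      coeff m (logDefect K (X 0 : MvPolynomial (Fin 2) K) (X 1) N) := by
    rw [add_comm, coeff_X_mul]
  have h2 := coeff_pderiv (i := 1) ((X 1 : MvPolynomial (Fin 2) K) * logDefect K (X 0) (X 1) N) m
  rw [h1, pderiv_mul_logDefect] at h2
  have hX : ∀ i, (X i : MvPolynomial (Fin 2) K) ∈ idealOfVars (Fin 2) K := fun i =>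
    Ideal.subset_span ⟨i, rfl⟩
  have h3 : ((-1) ^ (N + 1) * (X 0 * ∑ i ∈ Finset.range N,
        (X 0 + X 1 + X 0 * X 1) ^ i * X 1 ^ (N - 1 - i)) : MvPolynomial (Fin 2) K) ∈
      idealOfVars (Fin 2) K ^ N := by
    refine Ideal.mul_mem_left _ _ ?_
    rw [Finset.mul_sum]
    refine Ideal.sum_mem _ fun i hi => ?_
    have hi' := Finset.mem_range.mp hi
    have hN : idealOfVars (Fin 2) K ^ N =
        idealOfVars (Fin 2) K * (idealOfVars (Fin 2) K ^ i * idealOfVars (Fin 2) K ^ (N - 1 - i)) := by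
      rw [← pow_add, ← pow_succ']; congr 1; omega
    rw [hN]
    refine Ideal.mul_mem_mul (hX 0) (Ideal.mul_mem_mul (Ideal.pow_mem_pow ?_ _)
      (Ideal.pow_mem_pow (hX 1) _))
    exact add_mem (add_mem (hX 0) (hX 1)) (Ideal.mul_mem_right _ _ (hX 0))
  rw [(mem_pow_idealOfVars_iff' _ _).mp h3 m hm] at h2
  have h4 : ((m 1 : K) + 1) ≠ 0 := by exact_mod_cast Nat.succ_ne_zero (m 1)
  exact (mul_eq_zero.mp h2.symm).resolve_right h4

open scoped IsMulCommutative in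
/-- Two commuting elements of an algebra are the values of the variables under a homomorphism. -/
theorem exists_algHom_of_commute {R : Type*} [Ring R] [Algebra K R] {v c : R} (h : Commute v c) :
    ∃ f : MvPolynomial (Fin 2) K →ₐ[K] R, f (X 0) = v ∧ f (X 1) = c := by
  have hc : ∀ a ∈ ({v, c} : Set R), ∀ b ∈ ({v, c} : Set R), a * b = b * a := by
    rintro a (rfl | rfl) b (rfl | rfl)
    exacts [rfl, h.eq, h.eq.symm, rfl]
  have := Algebra.isMulCommutative_adjoin K hc
  let w : Fin 2 → Algebra.adjoin K ({v, c} : Set R) :=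
    ![⟨v, Algebra.subset_adjoin (by simp)⟩, ⟨c, Algebra.subset_adjoin (by simp)⟩]
  exact ⟨(Algebra.adjoin K ({v, c} : Set R)).val.comp (aeval w), by simp [w], by simp [w]⟩

theorem map_logDefect {R R' : Type*} [Ring R] [Algebra K R] [Ring R'] [Algebra K R']
    (f : R →ₐ[K] R') (v c : R) (N : ℕ) :
    f (logDefect K v c N) = logDefect K (f v) (f c) N := by
  simp [logDefect]

/-- If two commuting operators `v`, `c` raise a filtration by `1`, then `logDefect K v c N` raises
it by `N`. -/
theorem logDefect_mem {V : Type*} [AddCommGroup V] [Module K V] [CharZero K]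
    (F : ℕ → Submodule K V) (hF : Antitone F) {v c : Module.End K V} (h : Commute v c)
    (hv : ∀ n, ∀ x ∈ F n, v x ∈ F (n + 1)) (hc : ∀ n, ∀ x ∈ F n, c x ∈ F (n + 1)) (N n : ℕ)
    {x : V} (hx : x ∈ F n) : logDefect K v c N x ∈ F (n + N) := by
  obtain ⟨f, hf0, hf1⟩ := exists_algHom_of_commute K h
  have hp : ∀ {w : Module.End K V}, (∀ n, ∀ x ∈ F n, w x ∈ F (n + 1)) →
      ∀ j n, ∀ x ∈ F n, (w ^ j) x ∈ F (n + j) := by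
    intro w hw j
    induction j with
    | zero => intro n x hx; simpa using hx
    | succ j ih =>
      intro n x hx
      rw [pow_succ', Module.End.mul_apply]
      exact hw _ _ (ih n x hx)
  rw [← hf0, ← hf1, ← map_logDefect,
    ← support_sum_monomial_coeff (logDefect K (X 0 : MvPolynomial (Fin 2) K) (X 1) N), map_sum,
    LinearMap.sum_apply]
  refine Submodule.sum_mem _ fun m hm => ?_
  have hdeg : N ≤ m.degree := by
    by_contra hlt
    exact (mem_support_iff.mp hm) (coeff_logDefect K N m (not_le.mp hlt))
  have hd : m.degree = m 0 + m 1 := by simp [Finsupp.degree_eq_sum]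
  rw [monomial_eq, ← smul_eq_C_mul, map_smul, LinearMap.smul_apply]
  refine Submodule.smul_mem _ _ ?_
  rw [Finsupp.prod_fintype _ _ (by simp), Fin.prod_univ_two, map_mul, map_pow, map_pow, hf0, hf1,
    Module.End.mul_apply]
  refine hF ?_ (hp hv (m 0) _ _ (hp hc (m 1) _ _ hx))
  omega

end LogIdentity

end
end BCH


/-! ### Series in one of the two noncommuting variables. -/

namespace BCH
noncomputable section

open Finset.HasAntidiagonal (antidiagonal mem_antidiagonal)
open MvPowerSeries (coeff coeff_mul)

theorem sum_antidiagonal_assoc {M : Type*} [AddCommMonoid M] (n : ℕ) (f : ℕ → ℕ → ℕ → M) :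
    ∑ p ∈ antidiagonal n, ∑ q ∈ antidiagonal p.1, f q.1 q.2 p.2 =
      ∑ p ∈ antidiagonal n, ∑ q ∈ antidiagonal p.2, f p.1 q.1 q.2 := by
  rw [Finset.sum_sigma', Finset.sum_sigma']
  refine Finset.sum_nbij' (fun x => ⟨(x.2.1, x.2.2 + x.1.2), (x.2.2, x.1.2)⟩)
    (fun x => ⟨(x.1.1 + x.2.1, x.2.2), (x.1.1, x.2.1)⟩) ?_ ?_ ?_ ?_ ?_
  all_goals
    rintro ⟨⟨a, b⟩, ⟨c, d⟩⟩ h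
    simp only [Finset.mem_sigma, mem_antidiagonal] at h ⊢
  · obtain ⟨h1, rfl⟩ := h
    exact ⟨by omega, trivial⟩
  · obtain ⟨h1, rfl⟩ := h
    exact ⟨by omega, trivial⟩
  · obtain ⟨h1, rfl⟩ := h; rfl
  · obtain ⟨h1, rfl⟩ := h; rfl

section Series

variable {K : Type*} [Field K]

/-- The series `∑ gₙ xⁿ` in one of the two variables, with the variable of the free algebra
attached. -/
def ser (i : Fin 2) (g : PowerSeries K) : MvPowerSeries (Fin 2) (FreeAlgebra K (Fin 2)) :=
  fun m => if m = Finsupp.single i (m i) then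
    PowerSeries.coeff (m i) g • FreeAlgebra.ι K i ^ m i else 0

theorem coeff_ser (i : Fin 2) (g : PowerSeries K) (m : Fin 2 →₀ ℕ) :
    coeff m (ser i g) = if m = Finsupp.single i (m i) then
      PowerSeries.coeff (m i) g • FreeAlgebra.ι K i ^ m i else 0 := rfl

theorem coeff_ser_single (i : Fin 2) (g : PowerSeries K) (n : ℕ) :
    coeff (Finsupp.single i n) (ser i g) = PowerSeries.coeff n g • FreeAlgebra.ι K i ^ n := by
  simp [coeff_ser]

/-- The factor `ser i g` is supported on the `i`-axis, so the antidiagonal of `m` collapses to that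
of `m i`. -/
theorem coeff_ser_mul (i : Fin 2) (g : PowerSeries K)
    (F : MvPowerSeries (Fin 2) (FreeAlgebra K (Fin 2))) (m : Fin 2 →₀ ℕ) :
    coeff m (ser i g * F) = ∑ p ∈ antidiagonal (m i),
      (PowerSeries.coeff p.1 g • FreeAlgebra.ι K i ^ p.1) * coeff (m.update i p.2) F := by
  classical
  rw [coeff_mul]
  symm
  refine Finset.sum_of_injOn (fun p => (Finsupp.single i p.1, m.update i p.2)) ?_ ?_ ?_ ?_
  · rintro ⟨a, b⟩ _ ⟨a', b'⟩ _ h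
    simp only [Prod.mk.injEq] at h
    have h1 := DFunLike.congr_fun h.1 i
    have h2 := DFunLike.congr_fun h.2 i
    simp at h1 h2
    simp [h1, h2]
  · rintro ⟨a, b⟩ h
    simp only [Finset.mem_coe, mem_antidiagonal] at h ⊢
    ext j
    by_cases hj : j = i
    · subst hj; simp [h]
    · simp [hj]
  · rintro ⟨a, b⟩ h hn
    rw [coeff_ser, if_neg, zero_mul]
    intro ha
    simp only [mem_antidiagonal] at h
    apply hn
    refine ⟨(a i, b i), ?_, ?_⟩
    · simp [← h]
    · ext j
      · simp [← ha]
      · by_cases hj : j = i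
        · subst hj; simp
        · have h2 : a j = 0 := by
            have := DFunLike.congr_fun ha j
            simpa [Finsupp.single_apply, Ne.symm hj] using this
          simp [← h, hj, h2]
  · rintro ⟨a, b⟩ _
    simp [coeff_ser_single]

theorem coeff_mul_ser (i : Fin 2) (g : PowerSeries K)
    (F : MvPowerSeries (Fin 2) (FreeAlgebra K (Fin 2))) (m : Fin 2 →₀ ℕ) :
    coeff m (F * ser i g) = ∑ p ∈ antidiagonal (m i),
      coeff (m.update i p.1) F * (PowerSeries.coeff p.2 g • FreeAlgebra.ι K i ^ p.2) := by
  classical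
  rw [coeff_mul]
  symm
  refine Finset.sum_of_injOn (fun p => (m.update i p.1, Finsupp.single i p.2)) ?_ ?_ ?_ ?_
  · rintro ⟨a, b⟩ _ ⟨a', b'⟩ _ h
    simp only [Prod.mk.injEq] at h
    have h1 := DFunLike.congr_fun h.1 i
    have h2 := DFunLike.congr_fun h.2 i
    simp at h1 h2
    simp [h1, h2]
  · rintro ⟨a, b⟩ h
    simp only [Finset.mem_coe, mem_antidiagonal] at h ⊢
    ext j
    by_cases hj : j = i
    · subst hj; simp [h]
    · simp [hj]
  · rintro ⟨a, b⟩ h hn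
    rw [coeff_ser, if_neg, mul_zero]
    intro hb
    simp only [mem_antidiagonal] at h
    apply hn
    refine ⟨(a i, b i), ?_, ?_⟩
    · simp [← h]
    · ext j
      · by_cases hj : j = i
        · subst hj; simp
        · have h2 : b j = 0 := by
            have := DFunLike.congr_fun hb j
            simpa [Finsupp.single_apply, Ne.symm hj] using this
          simp [← h, hj, h2]
      · simp [← hb]
  · rintro ⟨a, b⟩ _
    simp [coeff_ser_single]

theorem ser_mul (i : Fin 2) (g g' : PowerSeries K) : ser i (g * g') = ser i g * ser i g' := by
  classical
  ext m
  rw [coeff_ser_mul, coeff_ser]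
  split_ifs with h
  · rw [PowerSeries.coeff_mul, Finset.sum_smul]
    refine Finset.sum_congr rfl fun p hp => ?_
    rw [h]
    have : (Finsupp.single i (m i)).update i p.2 = Finsupp.single i p.2 := by
      rw [← Finsupp.zero_update, Finsupp.update_idem, Finsupp.zero_update]
    rw [this, coeff_ser_single, smul_mul_smul_comm, ← pow_add, Finsupp.single_eq_same,
      mem_antidiagonal.mp hp]
  · symm
    refine Finset.sum_eq_zero fun p _ => ?_
    rw [coeff_ser, if_neg, mul_zero]
    intro h'
    apply h
    ext j
    have := DFunLike.congr_fun h' j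
    by_cases hj : j = i
    · subst hj; simp
    · simpa [hj, Finsupp.single_apply, Ne.symm hj] using this

theorem ser_one (i : Fin 2) : ser i (1 : PowerSeries K) = 1 := by
  classical
  ext m
  rw [coeff_ser, MvPowerSeries.coeff_one, PowerSeries.coeff_one]
  by_cases hm : m = 0
  · subst hm; simp
  · rw [if_neg hm]
    split_ifs with h1 h2
    · exact absurd (by rw [h1, h2]; simp) hm
    · simp
    · rfl

theorem ser_add (i : Fin 2) (g g' : PowerSeries K) : ser i (g + g') = ser i g + ser i g' := by
  ext m
  rw [map_add, coeff_ser, coeff_ser, coeff_ser]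
  split_ifs
  · rw [map_add, add_smul]
  · simp

theorem ser_smul (i : Fin 2) (r : K) (g : PowerSeries K) : ser i (r • g) = r • ser i g := by
  ext m
  change (ser i (r • g)) m = r • (ser i g) m
  simp only [ser, PowerSeries.coeff_smul, smul_ite, smul_zero, smul_assoc]

theorem ser_sub (i : Fin 2) (g g' : PowerSeries K) : ser i (g - g') = ser i g - ser i g' := by
  rw [eq_sub_iff_add_eq, ← ser_add, sub_add_cancel]

theorem expX_eq_ser [CharZero K] : expX K = ser 0 (PowerSeries.exp K) := by
  ext m
  have : (m = Finsupp.single 0 (m 0)) ↔ m 1 = 0 := by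
    constructor
    · intro h; rw [h]; simp
    · intro h; ext j; fin_cases j <;> simp [h]
  rw [coeff_ser]
  change (if m 1 = 0 then _ else _) = _
  simp [this, varX]

theorem expY_eq_ser [CharZero K] : expY K = ser 1 (PowerSeries.exp K) := by
  ext m
  have : (m = Finsupp.single 1 (m 1)) ↔ m 0 = 0 := by
    constructor
    · intro h; rw [h]; simp
    · intro h; ext j; fin_cases j <;> simp [h]
  rw [coeff_ser]
  change (if m 0 = 0 then _ else _) = _
  simp [this, varY]

end Series

end
end BCH


/-! ### The Dynkin-Specht-Wever formula for the BCH series. -/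

namespace BCH
noncomputable section

open Finset.HasAntidiagonal (antidiagonal mem_antidiagonal)
open MvPowerSeries (coeff coeff_mul)

section DynkinSpechtWever

variable (K : Type*) [Field K]

/-- The formal series in `X`, `Y`. -/
abbrev Ser := MvPowerSeries (Fin 2) (FreeAlgebra K (Fin 2))

/-- The formal series of order at least `n`. -/
def ordFilt (n : ℕ) : Submodule K (Ser K) where
  carrier := {F | ∀ m : Fin 2 →₀ ℕ, m.degree < n → coeff m F = 0}
  zero_mem' := fun m _ => map_zero _
  add_mem' := fun ha hb m hm => by rw [map_add, ha m hm, hb m hm, add_zero]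
  smul_mem' := fun r F hF m hm => by
    change r • coeff m F = 0
    rw [hF m hm, smul_zero]

variable {K}

theorem ordFilt_antitone : Antitone (ordFilt K) := fun _ _ h _ hF m hm => hF m (hm.trans_le h)

theorem mem_ordFilt_zero (F : Ser K) : F ∈ ordFilt K 0 := fun _ hm => absurd hm (Nat.not_lt_zero _)

theorem mem_ordFilt_one {F : Ser K} (h : coeff 0 F = 0) : F ∈ ordFilt K 1 := fun m hm => by
  rw [(Finsupp.degree_eq_zero_iff m).mp (by omega), h]

theorem mul_mem_ordFilt {a b : ℕ} {F G : Ser K} (hF : F ∈ ordFilt K a) (hG : G ∈ ordFilt K b) :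
    F * G ∈ ordFilt K (a + b) := by
  classical
  intro m hm
  rw [coeff_mul]
  refine Finset.sum_eq_zero fun p hp => ?_
  have hd : p.1.degree + p.2.degree = m.degree := by
    rw [← mem_antidiagonal.mp hp, map_add]
  by_cases h : p.1.degree < a
  · rw [hF _ h, zero_mul]
  · rw [hG _ (by omega), mul_zero]

variable (K) in
/-- The degree derivation on formal series. -/
def euler : Ser K →ₗ[K] Ser K where
  toFun F := fun m => (m.degree : K) • coeff m F
  map_add' F G := by
    ext m
    change (m.degree : K) • coeff m (F + G) = (m.degree : K) • coeff m F + (m.degree : K) • coeff m G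
    rw [map_add, smul_add]
  map_smul' r F := by
    ext m
    change (m.degree : K) • (r • coeff m F) = r • ((m.degree : K) • coeff m F)
    rw [smul_comm]

theorem coeff_euler (m : Fin 2 →₀ ℕ) (F : Ser K) :
    coeff m (euler K F) = (m.degree : K) • coeff m F := rfl

theorem euler_mul (F G : Ser K) : euler K (F * G) = euler K F * G + F * euler K G := by
  classical
  ext m
  rw [coeff_euler, map_add, coeff_mul, coeff_mul, coeff_mul, Finset.smul_sum,
    ← Finset.sum_add_distrib]
  refine Finset.sum_congr rfl fun p hp => ?_
  rw [coeff_euler, coeff_euler, smul_mul_assoc, mul_smul_comm, ← add_smul,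
    ← mem_antidiagonal.mp hp, map_add, Nat.cast_add]

theorem euler_one : euler K (1 : Ser K) = 0 := by
  have := euler_mul (1 : Ser K) 1
  simpa using this

theorem euler_pow (U : Ser K) (k : ℕ) :
    euler K (U ^ k) = (∑ i ∈ Finset.range k, LinearMap.mulLeft K U ^ i *
      LinearMap.mulRight K U ^ (k - 1 - i)) (euler K U) := by
  have hc : Commute (LinearMap.mulLeft K U) (LinearMap.mulRight K U) :=
    LinearMap.commute_mulLeft_right U U
  induction k with
  | zero => simp [euler_one]
  | succ k ih =>
    rw [pow_succ, euler_mul, ih, Nat.add_sub_cancel, hc.geom_sum₂_succ_eq, LinearMap.add_apply]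
    simp [LinearMap.pow_mulLeft, add_comm, Finset.sum_mul, mul_assoc]

variable (K) in
/-- The Dynkin map followed by the commutator expansion. -/
def dynkinAssoc : FreeAlgebra K (Fin 2) →ₗ[K] FreeAlgebra K (Fin 2) :=
  (lieToAssoc K).comp (dynkin K)

variable (K) in
/-- Commutation with a variable. -/
def adVar (i : Fin 2) : Module.End K (FreeAlgebra K (Fin 2)) :=
  LinearMap.mulLeft K (FreeAlgebra.ι K i) - LinearMap.mulRight K (FreeAlgebra.ι K i)

theorem dynkinAssoc_ι_mul (i : Fin 2) (v : FreeAlgebra K (Fin 2)) :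
    dynkinAssoc K (FreeAlgebra.ι K i * v) =
      adVar K i (dynkinAssoc K v) + aug K v • FreeAlgebra.ι K i := by
  simp [dynkinAssoc, dynkin_ι_mul, lieToAssoc_lie, lieToAssoc_of, adVar]

theorem dynkinAssoc_ι_pow_mul (i : Fin 2) (n : ℕ) {v : FreeAlgebra K (Fin 2)} (hv : aug K v = 0) :
    dynkinAssoc K (FreeAlgebra.ι K i ^ n * v) = (adVar K i ^ n) (dynkinAssoc K v) := by
  induction n with
  | zero => simp
  | succ n ih => simp [pow_succ', mul_assoc, dynkinAssoc_ι_mul, ih, hv]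

theorem dynkinAssoc_one : dynkinAssoc K 1 = 0 := by simp [dynkinAssoc, dynkin_one]

theorem dynkinAssoc_ι_pow (i : Fin 2) (n : ℕ) :
    dynkinAssoc K (FreeAlgebra.ι K i ^ n) = if n = 1 then FreeAlgebra.ι K i else 0 := by
  have h1 : dynkinAssoc K (FreeAlgebra.ι K i) = FreeAlgebra.ι K i := by
    simp [dynkinAssoc, dynkin_ι, lieToAssoc_of]
  match n with
  | 0 => simp [dynkinAssoc_one]
  | 1 => simp [h1]
  | n + 2 =>
    rw [pow_succ, dynkinAssoc_ι_pow_mul _ _ (aug_ι K i), h1, pow_succ, Module.End.mul_apply]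
    simp [adVar]

variable (K) in
/-- The coefficientwise application of `dynkinAssoc`. -/
def dynkinSer : Ser K →ₗ[K] Ser K where
  toFun F := fun m => dynkinAssoc K (coeff m F)
  map_add' F G := by ext m; change dynkinAssoc K _ = dynkinAssoc K _ + dynkinAssoc K _; simp
  map_smul' r F := by
    ext m
    change dynkinAssoc K (r • coeff m F) = r • dynkinAssoc K (coeff m F)
    rw [map_smul]

theorem coeff_dynkinSer (m : Fin 2 →₀ ℕ) (F : Ser K) :
    coeff m (dynkinSer K F) = dynkinAssoc K (coeff m F) := rfl

theorem inv_factorial_mul_choose [CharZero K] {j a k : ℕ} (h : a + k = j) :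
    (((j)! : ℕ) : K)⁻¹ * (j.choose a : K) = (((a)! : ℕ) : K)⁻¹ * (((k)! : ℕ) : K)⁻¹ := by
  subst h
  have h1 : ((a + k).choose a : K) * (a ! : ℕ) * (k ! : ℕ) = ((a + k)! : ℕ) := by
    rw [Nat.choose_symm_add]
    exact_mod_cast Nat.add_choose_mul_factorial_mul_factorial a k
  have h2 : ∀ n : ℕ, ((n ! : ℕ) : K) ≠ 0 := fun n => by exact_mod_cast Nat.factorial_ne_zero n
  have h3 := h2 (a + k)
  have h4 := h2 a
  have h5 := h2 k
  field_simp
  linear_combination h1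

theorem coeff_exp_field [CharZero K] (n : ℕ) :
    PowerSeries.coeff n (PowerSeries.exp K) = ((n ! : ℕ) : K)⁻¹ := by
  simp [PowerSeries.coeff_exp]

/-- Left multiplication by `x` is `ad x` plus right multiplication by `x`, and these commute. The
binomial theorem gives `exp x * H = (exp (ad x) H) * exp x` degree by degree. -/
theorem exp_smul_ι_pow_mul [CharZero K] (i : Fin 2) (j : ℕ) (H : FreeAlgebra K (Fin 2)) :
    (PowerSeries.coeff j (PowerSeries.exp K) • FreeAlgebra.ι K i ^ j) * H =
      ∑ q ∈ antidiagonal j, (PowerSeries.coeff q.1 (PowerSeries.exp K) • (adVar K i ^ q.1) H) *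
        (PowerSeries.coeff q.2 (PowerSeries.exp K) • FreeAlgebra.ι K i ^ q.2) := by
  have hc : Commute (adVar K i) (LinearMap.mulRight K (FreeAlgebra.ι K i)) :=
    (LinearMap.commute_mulLeft_right _ _).sub_left (Commute.refl _)
  have h := hc.add_pow' j
  rw [adVar, sub_add_cancel, LinearMap.pow_mulLeft, ← adVar] at h
  have h' := congrArg (fun f => f H) h
  simp only [LinearMap.mulLeft_apply, LinearMap.sum_apply] at h'
  rw [smul_mul_assoc, h', Finset.smul_sum]
  refine Finset.sum_congr rfl fun q hq => ?_
  rw [(hc.pow_pow q.1 q.2).eq, LinearMap.smul_apply, Module.End.mul_apply, LinearMap.pow_mulRight,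
    LinearMap.mulRight_apply, smul_mul_smul_comm, ← Nat.cast_smul_eq_nsmul K, smul_smul,
    coeff_exp_field, coeff_exp_field, coeff_exp_field,
    inv_factorial_mul_choose (mem_antidiagonal.mp hq)]

/-- On augmentation zero the Dynkin map turns left multiplication by `x` into `ad x`, hence by `exp
x` into `exp (ad x)`, which is conjugation by `exp x`. -/
theorem dynkinSer_exp_mul [CharZero K] (i : Fin 2) {G : Ser K} (hG : ∀ m, aug K (coeff m G) = 0) :
    dynkinSer K (ser i (PowerSeries.exp K) * G) * ser i (PowerSeries.exp K) =
      ser i (PowerSeries.exp K) * dynkinSer K G := by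
  ext m
  rw [coeff_mul_ser, coeff_ser_mul]
  simp only [coeff_dynkinSer, coeff_ser_mul]
  have hL : ∀ p ∈ antidiagonal (m i), dynkinAssoc K (∑ q ∈ antidiagonal (m.update i p.1 i),
      (PowerSeries.coeff q.1 (PowerSeries.exp K) • FreeAlgebra.ι K i ^ q.1) *
        coeff ((m.update i p.1).update i q.2) G) *
        (PowerSeries.coeff p.2 (PowerSeries.exp K) • FreeAlgebra.ι K i ^ p.2) =
      ∑ q ∈ antidiagonal p.1, (PowerSeries.coeff q.1 (PowerSeries.exp K) •
        (adVar K i ^ q.1) (dynkinAssoc K (coeff (m.update i q.2) G))) *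
        (PowerSeries.coeff p.2 (PowerSeries.exp K) • FreeAlgebra.ι K i ^ p.2) := by
    intro p _
    rw [map_sum, Finset.sum_mul]
    refine Finset.sum_congr (by simp) fun q _ => ?_
    rw [smul_mul_assoc, map_smul, dynkinAssoc_ι_pow_mul _ _ (hG _), Finsupp.update_idem]
  rw [Finset.sum_congr rfl hL]
  simp only [exp_smul_ι_pow_mul]
  rw [sum_antidiagonal_assoc (m i) fun a r k =>
    (PowerSeries.coeff a (PowerSeries.exp K) •
      (adVar K i ^ a) (dynkinAssoc K (coeff (m.update i r) G))) *
      (PowerSeries.coeff k (PowerSeries.exp K) • FreeAlgebra.ι K i ^ k),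
    sum_antidiagonal_assoc (m i) fun a k r => (PowerSeries.coeff a (PowerSeries.exp K) •
      (adVar K i ^ a) (dynkinAssoc K (coeff (m.update i r) G))) *
      (PowerSeries.coeff k (PowerSeries.exp K) • FreeAlgebra.ι K i ^ k)]
  refine Finset.sum_congr rfl fun p _ => ?_
  exact (Finset.Nat.sum_antidiagonal_swap (n := p.2) (f := fun q =>
    (PowerSeries.coeff p.1 (PowerSeries.exp K) •
      (adVar K i ^ p.1) (dynkinAssoc K (coeff (m.update i q.2) G))) *
      (PowerSeries.coeff q.1 (PowerSeries.exp K) • FreeAlgebra.ι K i ^ q.1)))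

/-- The inverse of the exponential series in one variable. -/
def expInv [CharZero K] (i : Fin 2) : Ser K := ser i (PowerSeries.exp K)⁻¹

theorem ser_exp_mul_expInv [CharZero K] (i : Fin 2) :
    ser i (PowerSeries.exp K) * expInv i = 1 := by
  rw [expInv, ← ser_mul, PowerSeries.mul_inv_cancel _ (by simp), ser_one]

theorem expInv_mul_ser_exp [CharZero K] (i : Fin 2) :
    expInv i * ser i (PowerSeries.exp K) = 1 := by
  rw [expInv, ← ser_mul, PowerSeries.inv_mul_cancel _ (by simp), ser_one]

theorem dynkinSer_exp_mul' [CharZero K] (i : Fin 2) {G : Ser K}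
    (hG : ∀ m, aug K (coeff m G) = 0) :
    dynkinSer K (ser i (PowerSeries.exp K) * G) =
      ser i (PowerSeries.exp K) * dynkinSer K G * expInv i := by
  rw [← dynkinSer_exp_mul i hG, mul_assoc, ser_exp_mul_expInv, mul_one]

theorem dynkinSer_ser_exp [CharZero K] (i : Fin 2) :
    dynkinSer K (ser i (PowerSeries.exp K)) = ser i (PowerSeries.X : PowerSeries K) := by
  ext m
  rw [coeff_dynkinSer, coeff_ser, coeff_ser]
  split_ifs with h
  · rw [map_smul, dynkinAssoc_ι_pow, PowerSeries.coeff_X]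
    split_ifs with h1
    · rw [h1]; simp [PowerSeries.coeff_exp]
    · simp
  · simp

theorem euler_ser_exp [CharZero K] (i : Fin 2) :
    euler K (ser i (PowerSeries.exp K)) =
      ser i (PowerSeries.X : PowerSeries K) * ser i (PowerSeries.exp K) := by
  rw [← ser_mul]
  ext m
  rw [coeff_euler, coeff_ser, coeff_ser]
  split_ifs with h
  · have hd : m.degree = m i := by conv_lhs => rw [h]; exact Finsupp.degree_single _ _
    rw [smul_smul, hd]
    congr 1
    cases hn : m i with
    | zero => simp
    | succ n =>
      rw [PowerSeries.coeff_succ_X_mul, coeff_exp_field, coeff_exp_field, Nat.factorial_succ]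
      have h1 : ((n + 1 : ℕ) : K) ≠ 0 := by exact_mod_cast Nat.succ_ne_zero n
      rw [Nat.cast_mul, mul_inv, ← mul_assoc, mul_inv_cancel₀ h1, one_mul]
  · simp

theorem map_aug_ser (i : Fin 2) (g : PowerSeries K) :
    MvPowerSeries.map (aug K).toRingHom (ser i g) =
      MvPowerSeries.C (PowerSeries.constantCoeff g) := by
  classical
  ext m
  rw [MvPowerSeries.coeff_map, coeff_ser, MvPowerSeries.coeff_C]
  by_cases hm : m = 0
  · subst hm; simp
  · rw [if_neg hm]
    split_ifs with h
    · have : m i ≠ 0 := fun h0 => hm (by rw [h, h0]; simp)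
      simp [this]
    · simp

variable (K) in
/-- The series `exp X * exp Y`. -/
def expProd : Ser K := expX K * expY K

variable (K) in
/-- The inverse of `exp X * exp Y`. -/
def expProdInv [CharZero K] : Ser K := expInv 1 * expInv 0

theorem expProdInv_mul [CharZero K] : expProdInv K * expProd K = 1 := by
  rw [expProd, expProdInv, expX_eq_ser, expY_eq_ser, mul_assoc, ← mul_assoc (expInv 0),
    expInv_mul_ser_exp, one_mul, expInv_mul_ser_exp]

theorem expProd_mul_inv [CharZero K] : expProd K * expProdInv K = 1 := by
  rw [expProd, expProdInv, expX_eq_ser, expY_eq_ser, mul_assoc, ← mul_assoc _ (expInv 1),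
    ser_exp_mul_expInv, one_mul, ser_exp_mul_expInv]

theorem map_aug_expProd [CharZero K] :
    MvPowerSeries.map (aug K).toRingHom (expProd K) = 1 := by
  rw [expProd, expX_eq_ser, expY_eq_ser, map_mul, map_aug_ser, map_aug_ser]
  simp

theorem aug_coeff_eq_zero {G : Ser K} (h : MvPowerSeries.map (aug K).toRingHom G = 0)
    (m : Fin 2 →₀ ℕ) : aug K (coeff m G) = 0 := by
  have := congrArg (coeff m) h
  simpa [MvPowerSeries.coeff_map] using this

theorem dynkinSer_expProd_mul [CharZero K] {G : Ser K}
    (hG : MvPowerSeries.map (aug K).toRingHom G = 0) :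
    dynkinSer K (expProd K * G) = expProd K * dynkinSer K G * expProdInv K := by
  rw [expProd, expX_eq_ser, expY_eq_ser, mul_assoc, dynkinSer_exp_mul', dynkinSer_exp_mul',
    expProdInv]
  · simp only [mul_assoc]
  · exact aug_coeff_eq_zero hG
  · apply aug_coeff_eq_zero
    rw [map_mul, hG, mul_zero]

theorem dynkinSer_one : dynkinSer K (1 : Ser K) = 0 := by
  classical
  ext m
  rw [coeff_dynkinSer, MvPowerSeries.coeff_one]
  split_ifs
  · simp [dynkinAssoc_one]
  · simp

/-- Here the Dynkin image of `U` is `exp X * Y * exp (-X) + X`; multiplied by `exp X * exp Y` on the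
right it becomes the Leibniz expansion of the degree derivation. -/
theorem euler_expProd [CharZero K] :
    euler K (expProd K - 1) = dynkinSer K (expProd K - 1) * expProd K := by
  have h1 : dynkinSer K (expProd K - 1) =
      ser 0 (PowerSeries.exp K) * ser 1 PowerSeries.X * expInv 0 + ser 0 PowerSeries.X := by
    have h2 : expProd K - 1 = ser 0 (PowerSeries.exp K) * (ser 1 (PowerSeries.exp K) - 1) +
        (ser 0 (PowerSeries.exp K) - 1) := by
      rw [expProd, expX_eq_ser, expY_eq_ser, mul_sub, mul_one]; abel
    rw [h2, map_add, dynkinSer_exp_mul', map_sub, map_sub, dynkinSer_one, dynkinSer_ser_exp,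
      dynkinSer_ser_exp, sub_zero, sub_zero]
    apply aug_coeff_eq_zero
    rw [map_sub, map_aug_ser]
    simp
  rw [h1, map_sub, euler_one, sub_zero, expProd, expX_eq_ser, expY_eq_ser, euler_mul,
    euler_ser_exp, euler_ser_exp, add_mul, add_comm]
  congr 1
  · rw [mul_assoc _ (expInv 0), ← mul_assoc (expInv 0), expInv_mul_ser_exp, one_mul, mul_assoc]
  · rw [mul_assoc]

variable (K) in
/-- Conjugation with `exp X * exp Y`, minus the identity. -/
def conjDefect [CharZero K] : Module.End K (Ser K) :=
  LinearMap.mulLeft K (expProd K) * LinearMap.mulRight K (expProdInv K) - 1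

theorem conjDefect_apply [CharZero K] (F : Ser K) :
    conjDefect K F = expProd K * (F * expProdInv K) - F := by
  simp [conjDefect]

/-- For `G` of augmentation zero, multiplication by `exp X * exp Y` becomes conjugation under the
Dynkin map, so multiplication by `U` becomes `conjDefect`. -/
theorem dynkinSer_pow [CharZero K] (k : ℕ) :
    dynkinSer K ((expProd K - 1) ^ (k + 1)) = (conjDefect K ^ k) (dynkinSer K (expProd K - 1)) := by
  have h0 : MvPowerSeries.map (aug K).toRingHom (expProd K - 1) = 0 := by
    rw [map_sub, map_aug_expProd, map_one, sub_self]
  induction k with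
  | zero => simp
  | succ k ih =>
    rw [pow_succ', sub_mul, one_mul, map_sub, dynkinSer_expProd_mul, ih, pow_succ' (conjDefect K),
      Module.End.mul_apply, conjDefect_apply, mul_assoc]
    rw [map_pow, h0, zero_pow (Nat.succ_ne_zero k)]

theorem commute_conjDefect [CharZero K] :
    Commute (LinearMap.mulRight K (expProd K - 1)) (conjDefect K) := by
  refine LinearMap.ext fun F => ?_
  simp only [Module.End.mul_apply, LinearMap.mulRight_apply, conjDefect_apply, mul_sub, sub_mul,
    mul_one, mul_assoc, expProd_mul_inv, expProdInv_mul]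
  abel

/-- Conjugating by `exp X * exp Y` and then multiplying by it on the right is multiplication on the
left. This is the relation `1 + u = (1 + v)(1 + c)` of `logDefect`, with `u`, `v` left and right
multiplication by `U`. -/
theorem mulLeft_eq [CharZero K] :
    LinearMap.mulRight K (expProd K - 1) + conjDefect K +
      LinearMap.mulRight K (expProd K - 1) * conjDefect K =
    LinearMap.mulLeft K (expProd K - 1) := by
  refine LinearMap.ext fun F => ?_
  simp only [LinearMap.add_apply, Module.End.mul_apply, LinearMap.mulRight_apply,
    LinearMap.mulLeft_apply, conjDefect_apply, mul_sub, sub_mul,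
    mul_one, one_mul, mul_assoc, expProdInv_mul]
  abel

variable (K) in
/-- The truncation of `log (exp X * exp Y)`. -/
def logTrunc (N : ℕ) : Ser K :=
  ∑ k ∈ Finset.Icc 1 N, ((-1 : K) ^ (k + 1) / (k : K)) • (expProd K - 1) ^ k

/-- The degree derivation of `U ^ k` gives `∑ uⁱ vᵏ⁻¹⁻ⁱ (1 + v)` and the Dynkin map gives `cᵏ⁻¹`,
both applied to the Dynkin image of `U`. Their difference is the `k`-th summand of `logDefect`. -/
theorem euler_sub_dynkinSer_logTrunc [CharZero K] (N : ℕ) :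
    euler K (logTrunc K N) - dynkinSer K (logTrunc K N) =
      logDefect K (LinearMap.mulRight K (expProd K - 1)) (conjDefect K) N
        (dynkinSer K (expProd K - 1)) := by
  rw [logTrunc, logDefect, map_sum, map_sum, ← Finset.sum_sub_distrib, LinearMap.sum_apply]
  refine Finset.sum_congr rfl fun k hk => ?_
  obtain ⟨k, rfl⟩ : ∃ j, k = j + 1 := ⟨k - 1, by have := (Finset.mem_Icc.mp hk).1; omega⟩
  rw [map_smul, map_smul, ← smul_sub, LinearMap.smul_apply, LinearMap.sub_apply, mulLeft_eq,
    dynkinSer_pow, euler_pow, Module.End.mul_apply, Nat.add_sub_cancel, euler_expProd]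
  congr 4
  simp [mul_sub]

theorem coeff_zero_expProd [CharZero K] : coeff 0 (expProd K) = 1 := by
  rw [expProd, expX_eq_ser, expY_eq_ser, MvPowerSeries.coeff_zero_eq_constantCoeff, map_mul,
    ← MvPowerSeries.coeff_zero_eq_constantCoeff]
  simp [coeff_ser]

/-- The Dynkin-Specht-Wever formula for the Baker-Campbell-Hausdorff series. -/
theorem dynkinAssoc_bchAssoc [CharZero K] (p q : ℕ) :
    dynkinAssoc K (bchAssoc K p q) = ((p + q : ℕ) : K) • bchAssoc K p q := by
  have hU : (expProd K - 1) ∈ ordFilt K 1 :=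
    mem_ordFilt_one (by rw [map_sub, coeff_zero_expProd]; simp)
  have hU' : (expProdInv K - 1) ∈ ordFilt K 1 := by
    have : expProdInv K - 1 = - ((expProd K - 1) * expProdInv K) := by
      rw [sub_mul, expProd_mul_inv]; simp
    rw [this]
    exact neg_mem (mul_mem_ordFilt hU (mem_ordFilt_zero _))
  have hW : dynkinSer K (expProd K - 1) ∈ ordFilt K 1 := fun m hm => by
    rw [coeff_dynkinSer, hU m hm, map_zero]
  have hv : ∀ n, ∀ F ∈ ordFilt K n, LinearMap.mulRight K (expProd K - 1) F ∈ ordFilt K (n + 1) :=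
    fun n F hF => mul_mem_ordFilt hF hU
  have hc : ∀ n, ∀ F ∈ ordFilt K n, conjDefect K F ∈ ordFilt K (n + 1) := by
    intro n F hF
    have : conjDefect K F = (expProd K - 1) * (F * expProdInv K) + F * (expProdInv K - 1) := by
      rw [conjDefect_apply]; noncomm_ring
    rw [this]
    refine add_mem ?_ (mul_mem_ordFilt hF hU')
    rw [add_comm n 1]
    exact mul_mem_ordFilt hU (mul_mem_ordFilt (b := 0) hF (mem_ordFilt_zero _))
  -- The Dynkin image of `U` has order at least `1`, so the defect has order at least `p + q + 1`
  -- and misses the bidegree `(p, q)`.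
  have h := logDefect_mem K (ordFilt K) ordFilt_antitone commute_conjDefect hv hc (p + q) 1 hW
  rw [← euler_sub_dynkinSer_logTrunc] at h
  have hdeg : (expo p q).degree = p + q := by simp [expo]
  have h2 := h (expo p q) (by omega)
  have h3 : coeff (expo p q) (logTrunc K (p + q)) = bchAssoc K p q := by
    rw [logTrunc, map_sum, bchAssoc]
    rfl
  rw [map_sub, coeff_euler, coeff_dynkinSer, h3, hdeg, sub_eq_zero] at h2
  exact h2.symm

theorem bchAssoc_zero : bchAssoc K 0 0 = 0 := by simp [bchAssoc]

theorem lieToAssoc_dynkin_bchAssoc [CharZero K] (p q : ℕ) :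
    lieToAssoc K (((p + q : ℕ) : K)⁻¹ • dynkin K (bchAssoc K p q)) = bchAssoc K p q := by
  rw [map_smul]
  change _ • dynkinAssoc K _ = _
  rw [dynkinAssoc_bchAssoc]
  by_cases h : p + q = 0
  · obtain ⟨rfl, rfl⟩ := Nat.add_eq_zero_iff.mp h
    simp [bchAssoc_zero]
  · rw [smul_smul, inv_mul_cancel₀ (by exact_mod_cast h), one_smul]

theorem existsUnique_lieToAssoc_eq_bchAssoc [CharZero K] (p q : ℕ) :
    ∃! P : FreeLieAlgebra K (Fin 2), lieToAssoc K P = bchAssoc K p q :=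
  ⟨_, lieToAssoc_dynkin_bchAssoc p q, fun _ hP =>
    lieToAssoc_injective K (hP.trans (lieToAssoc_dynkin_bchAssoc p q).symm)⟩

theorem bchLie_eq [CharZero K] (p q : ℕ) :
    bchLie K p q = ((p + q : ℕ) : K)⁻¹ • dynkin K (bchAssoc K p q) := by
  have h : ∃ P, lieToAssoc K P = bchAssoc K p q := ⟨_, lieToAssoc_dynkin_bchAssoc p q⟩
  exact lieToAssoc_injective K
    ((Classical.epsilon_spec h).trans (lieToAssoc_dynkin_bchAssoc p q).symm)

end DynkinSpechtWever

end
end BCH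


/-! ### The majorant Riccati equation and its solution. -/

namespace BCH
noncomputable section

open Set Filter Topology

section Riccati

/-- The entire function `∑ vᵏ / (2k)!`, that is `cosh √v`. -/
def coshSqrt (v : ℝ) : ℝ := ∑' k : ℕ, v ^ k / ((2 * k)! : ℕ)

/-- The entire function `∑ vᵏ / (2k+1)!`, that is `sinh √v / √v`. -/
def sinhcSqrt (v : ℝ) : ℝ := ∑' k : ℕ, v ^ k / ((2 * k + 1)! : ℕ)

theorem hasSum_cosh_sq (w : ℝ) : HasSum (fun k : ℕ => (w ^ 2) ^ k / ((2 * k)! : ℕ)) (Real.cosh w) := by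
  simpa [pow_mul] using Real.hasSum_cosh w

theorem HasSum.of_eq {f g : ℕ → ℝ} {a : ℝ} (hf : HasSum f a) (h : ∀ k, f k = g k) : HasSum g a :=
  (funext h : f = g) ▸ hf

theorem hasSum_cos_sq (w : ℝ) :
    HasSum (fun k : ℕ => (-w ^ 2) ^ k / ((2 * k)! : ℕ)) (Real.cos w) := by
  refine HasSum.of_eq (Real.hasSum_cos w) fun k => ?_
  rw [neg_pow (w ^ 2), pow_mul]

theorem hasSum_sinh_sq {w : ℝ} (hw : w ≠ 0) :
    HasSum (fun k : ℕ => (w ^ 2) ^ k / ((2 * k + 1)! : ℕ)) (Real.sinh w / w) := by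
  refine HasSum.of_eq ((Real.hasSum_sinh w).div_const w) fun k => ?_
  rw [pow_succ, pow_mul]; field_simp

theorem hasSum_sin_sq {w : ℝ} (hw : w ≠ 0) :
    HasSum (fun k : ℕ => (-w ^ 2) ^ k / ((2 * k + 1)! : ℕ)) (Real.sin w / w) := by
  refine HasSum.of_eq ((Real.hasSum_sin w).div_const w) fun k => ?_
  rw [neg_pow (w ^ 2), pow_succ w, pow_mul]; field_simp

theorem coshSqrt_sq (w : ℝ) : coshSqrt (w ^ 2) = Real.cosh w := (hasSum_cosh_sq w).tsum_eq

theorem coshSqrt_neg_sq (w : ℝ) : coshSqrt (-w ^ 2) = Real.cos w := (hasSum_cos_sq w).tsum_eq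

theorem sinhcSqrt_zero : sinhcSqrt 0 = 1 := by
  rw [sinhcSqrt, tsum_eq_single 0] <;> simp +contextual

theorem mul_sinhcSqrt_sq (w : ℝ) : w * sinhcSqrt (w ^ 2) = Real.sinh w := by
  rcases eq_or_ne w 0 with rfl | hw
  · simp
  · rw [sinhcSqrt, (hasSum_sinh_sq hw).tsum_eq, mul_div_cancel₀ _ hw]

theorem mul_sinhcSqrt_neg_sq (w : ℝ) : w * sinhcSqrt (-w ^ 2) = Real.sin w := by
  rcases eq_or_ne w 0 with rfl | hw
  · simp
  · rw [sinhcSqrt, (hasSum_sin_sq hw).tsum_eq, mul_div_cancel₀ _ hw]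

theorem summable_coshSqrt (v : ℝ) : Summable fun k : ℕ => v ^ k / ((2 * k)! : ℕ) := by
  have h := (hasSum_cosh_sq (√|v|)).summable
  rw [Real.sq_sqrt (abs_nonneg v)] at h
  refine Summable.of_norm (h.congr fun k => ?_)
  simp

theorem summable_sinhcSqrt (v : ℝ) : Summable fun k : ℕ => v ^ k / ((2 * k + 1)! : ℕ) := by
  refine Summable.of_norm ((summable_coshSqrt |v|).of_nonneg_of_le (fun k => norm_nonneg _)
    fun k => ?_)
  rw [norm_div, norm_pow, Real.norm_eq_abs, Real.norm_natCast]
  gcongr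
  omega

theorem continuous_coshSqrt : Continuous coshSqrt := by
  rw [continuous_iff_continuousAt]
  intro v
  have h : ContinuousOn coshSqrt (Metric.ball 0 (|v| + 1)) := by
    refine continuousOn_tsum (fun k => by fun_prop) (summable_coshSqrt (|v| + 1)) fun k x hx => ?_
    rw [norm_div, norm_pow, Real.norm_natCast]
    gcongr
    exact (mem_ball_zero_iff.mp hx).le
  exact h.continuousAt (Metric.isOpen_ball.mem_nhds (by simp))

theorem continuous_sinhcSqrt : Continuous sinhcSqrt := by
  rw [continuous_iff_continuousAt]
  intro v
  have h : ContinuousOn sinhcSqrt (Metric.ball 0 (|v| + 1)) := by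
    refine continuousOn_tsum (fun k => by fun_prop) (summable_sinhcSqrt (|v| + 1)) fun k x hx => ?_
    rw [norm_div, norm_pow, Real.norm_natCast]
    gcongr
    exact (mem_ball_zero_iff.mp hx).le
  exact h.continuousAt (Metric.isOpen_ball.mem_nhds (by simp))

/-- The solution of `C'' = u / 4 * C` with `C 0 = 1`, `C' 0 = 0`. -/
def cSol (u t : ℝ) : ℝ := coshSqrt (u * t ^ 2 / 4)

/-- The solution of `S'' = u / 4 * S` with `S 0 = 0`, `S' 0 = 1`. -/
def sSol (u t : ℝ) : ℝ := t * sinhcSqrt (u * t ^ 2 / 4)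

theorem cSol_neg (w t : ℝ) : cSol (-(4 * w ^ 2)) t = Real.cos (w * t) := by
  rw [cSol, ← coshSqrt_neg_sq]; congr 1; ring

theorem cSol_pos (w t : ℝ) : cSol (4 * w ^ 2) t = Real.cosh (w * t) := by
  rw [cSol, ← coshSqrt_sq]; congr 1; ring

theorem sSol_neg {w : ℝ} (hw : w ≠ 0) (t : ℝ) : sSol (-(4 * w ^ 2)) t = Real.sin (w * t) / w := by
  rw [sSol, ← mul_sinhcSqrt_neg_sq, eq_div_iff hw]
  have : -(4 * w ^ 2) * t ^ 2 / 4 = -(w * t) ^ 2 := by ring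
  rw [this]; ring

theorem sSol_pos {w : ℝ} (hw : w ≠ 0) (t : ℝ) : sSol (4 * w ^ 2) t = Real.sinh (w * t) / w := by
  rw [sSol, ← mul_sinhcSqrt_sq, eq_div_iff hw]
  have : (4 * w ^ 2) * t ^ 2 / 4 = (w * t) ^ 2 := by ring
  rw [this]; ring

theorem cSol_zero_left (t : ℝ) : cSol 0 t = 1 := by simpa using cSol_pos 0 t

theorem sSol_zero_left (t : ℝ) : sSol 0 t = t := by simp [sSol, sinhcSqrt_zero]

theorem eq_sq_or (u : ℝ) : u = 0 ∨ (∃ w ≠ 0, u = 4 * w ^ 2) ∨ ∃ w ≠ 0, u = -(4 * w ^ 2) := by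
  rcases lt_trichotomy u 0 with h | h | h
  · refine Or.inr (Or.inr ⟨√(-u) / 2, by have := Real.sqrt_pos.mpr (neg_pos.mpr h); positivity, ?_⟩)
    rw [div_pow, Real.sq_sqrt (by linarith)]; ring
  · exact Or.inl h
  · refine Or.inr (Or.inl ⟨√u / 2, by have := Real.sqrt_pos.mpr h; positivity, ?_⟩)
    rw [div_pow, Real.sq_sqrt h.le]; ring

theorem hasDerivAt_cSol (u t : ℝ) : HasDerivAt (cSol u) (u / 4 * sSol u t) t := by
  rcases eq_sq_or u with rfl | ⟨w, hw, rfl⟩ | ⟨w, hw, rfl⟩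
  · rw [funext cSol_zero_left]; simpa using hasDerivAt_const t (1 : ℝ)
  · rw [funext (cSol_pos w), sSol_pos hw]
    refine ((hasDerivAt_id' t).const_mul w).cosh.congr_deriv ?_
    field_simp
  · rw [funext (cSol_neg w), sSol_neg hw]
    refine ((hasDerivAt_id' t).const_mul w).cos.congr_deriv ?_
    field_simp

theorem hasDerivAt_sSol (u t : ℝ) : HasDerivAt (sSol u) (cSol u t) t := by
  rcases eq_sq_or u with rfl | ⟨w, hw, rfl⟩ | ⟨w, hw, rfl⟩
  · rw [funext sSol_zero_left, cSol_zero_left]; exact hasDerivAt_id t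
  · rw [funext (sSol_pos hw), cSol_pos]
    refine (((hasDerivAt_id' t).const_mul w).sinh.div_const w).congr_deriv ?_
    field_simp
  · rw [funext (sSol_neg hw), cSol_neg]
    refine (((hasDerivAt_id' t).const_mul w).sin.div_const w).congr_deriv ?_
    field_simp

theorem cSol_add (u x y : ℝ) :
    cSol u (x + y) = cSol u x * cSol u y + u / 4 * (sSol u x * sSol u y) := by
  rcases eq_sq_or u with rfl | ⟨w, hw, rfl⟩ | ⟨w, hw, rfl⟩
  · simp [cSol_zero_left]
  · simp only [cSol_pos, sSol_pos hw, mul_add, Real.cosh_add]; field_simp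
  · simp only [cSol_neg, sSol_neg hw, mul_add, Real.cos_add]; field_simp; ring

theorem sSol_add (u x y : ℝ) :
    sSol u (x + y) = sSol u x * cSol u y + cSol u x * sSol u y := by
  rcases eq_sq_or u with rfl | ⟨w, hw, rfl⟩ | ⟨w, hw, rfl⟩
  · simp [cSol_zero_left, sSol_zero_left]
  · simp only [cSol_pos, sSol_pos hw, mul_add, Real.sinh_add]; field_simp
  · simp only [cSol_neg, sSol_neg hw, mul_add, Real.sin_add]; field_simp

/-- The denominator of the solution `sSol / riccatiDen` of `r' = 1 + d r + (1 - d²) / 4 * r²`. -/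
def riccatiDen (d t : ℝ) : ℝ := cSol (2 * d ^ 2 - 1) t - d / 2 * sSol (2 * d ^ 2 - 1) t

/-- This converts the condition that the product of the solutions at `x` and `y` is less than `4 /
(1 - d²)` into positivity of the denominator at `x + y`. -/
theorem riccatiDen_add (d x y : ℝ) :
    riccatiDen d (x + y) = riccatiDen d x * riccatiDen d y -
      (1 - d ^ 2) / 4 * (sSol (2 * d ^ 2 - 1) x * sSol (2 * d ^ 2 - 1) y) := by
  simp only [riccatiDen, cSol_add, sSol_add]; ring

theorem hasDerivAt_riccatiDen (d t : ℝ) : HasDerivAt (riccatiDen d)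
    ((2 * d ^ 2 - 1) / 4 * sSol (2 * d ^ 2 - 1) t - d / 2 * cSol (2 * d ^ 2 - 1) t) t :=
  (hasDerivAt_cSol _ t).sub ((hasDerivAt_sSol _ t).const_mul _)

/-- Writing the solutions with entire functions of `u` makes them continuous through `u = 0`, where
the formulas change type; the compactness argument in `exists_bound` relies on this. -/
theorem continuous_riccatiDen_left (t : ℝ) : Continuous fun d => riccatiDen d t := by
  have h1 := continuous_coshSqrt
  have h2 := continuous_sinhcSqrt
  unfold riccatiDen cSol sSol
  fun_prop

theorem continuous_sSol_left (t : ℝ) : Continuous fun d : ℝ => sSol (2 * d ^ 2 - 1) t := by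
  have h2 := continuous_sinhcSqrt
  unfold sSol
  fun_prop

theorem riccatiDen_one (t : ℝ) : riccatiDen 1 t = Real.exp (-(t / 2)) := by
  have h : (2 * (1 : ℝ) ^ 2 - 1) = 4 * (1 / 2) ^ 2 := by norm_num
  rw [riccatiDen, h, cSol_pos, sSol_pos (by norm_num), ← Real.cosh_sub_sinh]
  ring_nf

/-- A subsolution of the Riccati equation is bounded by the solution. -/
theorem mul_riccatiDen_le {d x : ℝ} (hx : 0 ≤ x)
    (hD : ∀ t ∈ Icc 0 x, 0 ≤ riccatiDen d t) {P P' : ℝ → ℝ} (hP : ∀ t, HasDerivAt P (P' t) t)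
    (hP0 : P 0 = 0)
    (hle : ∀ t ∈ Icc 0 x, P' t ≤ 1 + d * P t + (1 - d ^ 2) / 4 * P t ^ 2) :
    P x * riccatiDen d x ≤ sSol (2 * d ^ 2 - 1) x := by
  have hPc : Continuous P := continuous_iff_continuousAt.mpr fun t => (hP t).continuousAt
  set c := (1 - d ^ 2) / 4
  set u := 2 * d ^ 2 - 1
  have hk : Continuous fun s => d / 2 + c * P s := by fun_prop
  set Φ : ℝ → ℝ := fun t => ∫ s in (0 : ℝ)..t, (d / 2 + c * P s)
  have hΦ : ∀ t, HasDerivAt Φ (d / 2 + c * P t) t := fun t =>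
    intervalIntegral.integral_hasDerivAt_right (hk.intervalIntegrable _ _)
      (hk.stronglyMeasurableAtFilter _ _) hk.continuousAt
  -- With `D' = -(d/2) D - c S` and `S' = D + (d/2) S`, the derivative of `P D - S` is `(P' - 1 - d
  -- P - c P²) D + (d/2 + c P)(P D - S)`. The factor `exp (-Φ)` absorbs the last term, and no
  -- division by `D` is needed.
  have hQ : ∀ t, HasDerivAt (fun t => (P t * riccatiDen d t - sSol u t) * Real.exp (-Φ t))
      ((P' t - (1 + d * P t + c * P t ^ 2)) * riccatiDen d t * Real.exp (-Φ t)) t := by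
    intro t
    refine ((((hP t).fun_mul (hasDerivAt_riccatiDen d t)).fun_sub (hasDerivAt_sSol u t)).fun_mul
      (hΦ t).fun_neg.exp).congr_deriv ?_
    simp only [riccatiDen, u, c]
    ring
  have hanti : AntitoneOn (fun t => (P t * riccatiDen d t - sSol u t) * Real.exp (-Φ t))
      (Icc 0 x) := by
    refine antitoneOn_of_hasDerivWithinAt_nonpos (convex_Icc 0 x)
      (fun t _ => (hQ t).continuousAt.continuousWithinAt) (fun t _ => (hQ t).hasDerivWithinAt)
      fun t ht => ?_
    have ht' := interior_subset ht
    exact mul_nonpos_of_nonpos_of_nonneg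
      (mul_nonpos_of_nonpos_of_nonneg (by linarith [hle t ht']) (hD t ht')) (Real.exp_pos _).le
  have h := hanti (left_mem_Icc.mpr hx) (right_mem_Icc.mpr hx) hx
  simp only [hP0, sSol, zero_mul, sub_zero] at h
  have := nonpos_of_mul_nonpos_left h (Real.exp_pos _)
  simp only [sSol]
  linarith

/-- Each partial sum is itself a subsolution: its derivative involves only products `g i * g j` with
`i + j < N`, which form part of the square of the partial sum, and the remaining products are
nonnegative. -/
theorem sum_mul_riccatiDen_le {d x : ℝ} (hd : d ∈ Icc (0 : ℝ) 1) (hx : 0 ≤ x)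
    (hD : ∀ t ∈ Icc 0 x, 0 ≤ riccatiDen d t) {g : ℕ → ℝ} (hg : ∀ i, 0 ≤ g i) (hg0 : g 0 = 0)
    (hrec : ∀ i, (i + 1) * g (i + 1) ≤ (if i = 0 then 1 else 0) + d * g i +
      (1 - d ^ 2) / 4 * ∑ p ∈ Finset.HasAntidiagonal.antidiagonal i, g p.1 * g p.2) (N : ℕ) :
    (∑ i ∈ Finset.range (N + 1), g i * x ^ i) * riccatiDen d x ≤ sSol (2 * d ^ 2 - 1) x := by
  refine mul_riccatiDen_le hx hD (P := fun t => ∑ i ∈ Finset.range (N + 1), g i * t ^ i)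
    (P' := fun t => ∑ i ∈ Finset.range (N + 1), g i * (i * t ^ (i - 1))) (fun t => ?_) ?_ ?_
  · exact HasDerivAt.fun_sum fun i _ => (hasDerivAt_pow i t).const_mul _
  · rw [Finset.sum_range_succ']; simp [hg0]
  · intro t ht
    have ht0 := ht.1
    have hc : 0 ≤ (1 - d ^ 2) / 4 := by nlinarith [hd.1, hd.2]
    rw [Finset.sum_range_succ']
    have h1 : ∀ i ∈ Finset.range N, g (i + 1) * ((i + 1 : ℕ) * t ^ (i + 1 - 1)) ≤
        (if i = 0 then 1 else 0) + d * (g i * t ^ i) + (1 - d ^ 2) / 4 *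
          ∑ p ∈ Finset.HasAntidiagonal.antidiagonal i, (g p.1 * t ^ p.1) * (g p.2 * t ^ p.2) := by
      intro i _
      have h2 : ∑ p ∈ Finset.HasAntidiagonal.antidiagonal i,
          (g p.1 * t ^ p.1) * (g p.2 * t ^ p.2) =
          (∑ p ∈ Finset.HasAntidiagonal.antidiagonal i, g p.1 * g p.2) * t ^ i := by
        rw [Finset.sum_mul]
        refine Finset.sum_congr rfl fun p hp => ?_
        rw [← Finset.HasAntidiagonal.mem_antidiagonal.mp hp, pow_add]; ring
      have h3 : (if i = 0 then (1 : ℝ) else 0) = (if i = 0 then 1 else 0) * t ^ i := by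
        split_ifs with h
        · simp [h]
        · simp
      rw [h2, h3, Nat.add_sub_cancel]
      push_cast
      have := mul_le_mul_of_nonneg_right (hrec i) (pow_nonneg ht0 i)
      linarith
    refine (add_le_add (Finset.sum_le_sum h1) (le_of_eq (by simp : _ = (0 : ℝ)))).trans ?_
    rw [Finset.sum_add_distrib, Finset.sum_add_distrib, ← Finset.mul_sum, ← Finset.mul_sum, add_zero]
    refine add_le_add (add_le_add ?_ ?_) ?_
    · rw [Finset.sum_ite_eq' (Finset.range N) 0 (fun _ => (1 : ℝ))]
      split_ifs <;> norm_num
    · refine mul_le_mul_of_nonneg_left ?_ hd.1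
      exact Finset.sum_le_sum_of_subset_of_nonneg (by simp) fun i _ _ =>
        mul_nonneg (hg i) (pow_nonneg ht0 i)
    · refine mul_le_mul_of_nonneg_left ?_ hc
      rw [pow_two, Finset.sum_mul_sum, ← Finset.sum_product', Finset.sum_sigma']
      have hinj : Set.InjOn (fun q : (Σ _ : ℕ, ℕ × ℕ) => q.2)
          ((Finset.range N).sigma fun i => Finset.HasAntidiagonal.antidiagonal i) := by
        rintro ⟨i, p⟩ hp ⟨i', p'⟩ hp' rfl
        simp only [Finset.coe_sigma, Set.mem_sigma_iff, Finset.mem_coe,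
          Finset.HasAntidiagonal.mem_antidiagonal] at hp hp'
        rw [Sigma.mk.injEq]
        exact ⟨hp.2.symm.trans hp'.2, HEq.rfl⟩
      rw [← Finset.sum_image (f := fun p : ℕ × ℕ => g p.1 * t ^ p.1 * (g p.2 * t ^ p.2)) hinj]
      refine Finset.sum_le_sum_of_subset_of_nonneg ?_ fun p _ _ => by
        have h4 := hg p.1
        have h5 := hg p.2
        positivity
      intro p hp
      simp only [Finset.mem_image, Finset.mem_sigma, Finset.mem_range,
        Finset.HasAntidiagonal.mem_antidiagonal, Finset.mem_product] at hp ⊢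
      obtain ⟨q, hq, rfl⟩ := hp
      omega

end Riccati

end
end BCH


/-! ### Zeros of the Riccati denominator and the constant `C₁`. -/

namespace BCH
noncomputable section

open Set Filter Topology

section Radius

theorem h_half : h (1 / 2) = Real.pi := by simp [h]

theorem h_of_zero {l : ℝ} (hl : 8 * l ^ 2 - 8 * l + 1 = 0) : h l = 2 * √2 := by
  have : l ≠ 1 / 2 := by rintro rfl; norm_num at hl
  simp only [h, hl, if_neg this]; simp

theorem h_of_neg {l w : ℝ} (hl : l ≠ 1 / 2) (hw : 0 < w)
    (hu : 8 * l ^ 2 - 8 * l + 1 = -(4 * w ^ 2)) :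
    h l = Real.arctan (2 * w / |1 - 2 * l|) / w := by
  have h1 : -(4 * w ^ 2) < 0 := by nlinarith
  have h2 : √(- -(4 * w ^ 2)) = 2 * w := by
    rw [neg_neg, show 4 * w ^ 2 = (2 * w) ^ 2 by ring, Real.sqrt_sq (by linarith)]
  simp only [h, hu, if_neg hl, if_pos h1, h2]
  field_simp

theorem h_of_pos {l w : ℝ} (hw : 0 < w) (hu : 8 * l ^ 2 - 8 * l + 1 = 4 * w ^ 2) :
    h l = Real.artanh (2 * w / |1 - 2 * l|) / w := by
  have hl : l ≠ 1 / 2 := by rintro rfl; nlinarith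
  have h1 : 0 < 4 * w ^ 2 := by positivity
  have h2 : √(4 * w ^ 2) = 2 * w := by
    rw [show 4 * w ^ 2 = (2 * w) ^ 2 by ring, Real.sqrt_sq (by linarith)]
  simp only [h, hu, if_neg hl, if_neg h1.not_gt, if_neg h1.ne', h2]
  field_simp

theorem exists_pos_of_eq_sq {a u : ℝ} (hu : ∃ w ≠ 0, u = a * w ^ 2) : ∃ w > 0, u = a * w ^ 2 := by
  obtain ⟨w, hw, rfl⟩ := hu
  exact ⟨|w|, abs_pos.mpr hw, by rw [sq_abs]⟩

theorem two_mul_sq_abs_sub_one (l : ℝ) : 2 * |1 - 2 * l| ^ 2 - 1 = 8 * l ^ 2 - 8 * l + 1 := by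
  rw [sq_abs]; ring

theorem quot_mem_Ioo {l w : ℝ} (hl : l ∈ Ioo (0 : ℝ) 1) (hw : 0 < w)
    (hu : 8 * l ^ 2 - 8 * l + 1 = 4 * w ^ 2) :
    0 < |1 - 2 * l| ∧ 2 * w / |1 - 2 * l| ∈ Ioo (-1 : ℝ) 1 := by
  have hd : 0 < |1 - 2 * l| := by
    rw [abs_pos]; intro h0
    have : l = 1 / 2 := by linarith
    subst this; nlinarith
  have h1 : 2 * w < |1 - 2 * l| := by
    refine lt_of_pow_lt_pow_left₀ 2 hd.le ?_
    rw [sq_abs]; nlinarith [hl.1, hl.2, mul_pos hl.1 (sub_pos.mpr hl.2)]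
  exact ⟨hd, by have : 0 < 2 * w / |1 - 2 * l| := by positivity
                linarith, by rwa [div_lt_one hd]⟩

theorem tanh_mul_cosh (x : ℝ) : Real.tanh x * Real.cosh x = Real.sinh x := by
  rw [Real.tanh_eq_sinh_div_cosh, div_mul_cancel₀ _ (Real.cosh_pos x).ne']

/-- With `8l² - 8l + 1 = ±4w²` and `d = |1 - 2l| > 0`, positivity of the denominator reads `tanh (w
t) < 2w / d`, respectively `tan (w t) < 2w / d` on the first branch of the tangent; `h l` is the
point of equality. -/
theorem riccatiDen_pos_of_lt {l t : ℝ} (hl : l ∈ Ioo (0 : ℝ) 1) (ht : 0 ≤ t) (hlt : t < h l) :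
    0 < riccatiDen |1 - 2 * l| t := by
  by_cases hhalf : l = 1 / 2
  · subst hhalf
    rw [h_half] at hlt
    have h1 : |1 - 2 * (1 / 2 : ℝ)| = 0 := by norm_num
    have h2 : (2 * (0 : ℝ) ^ 2 - 1) = -(4 * (1 / 2) ^ 2) := by norm_num
    rw [h1, riccatiDen, h2, cSol_neg, zero_div, zero_mul, sub_zero]
    exact Real.cos_pos_of_mem_Ioo ⟨by linarith [Real.pi_pos], by linarith⟩
  have hd : 0 < |1 - 2 * l| := abs_pos.mpr fun h0 => hhalf (by linarith)
  rw [riccatiDen, two_mul_sq_abs_sub_one]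
  rcases eq_sq_or (8 * l ^ 2 - 8 * l + 1) with hu | hu | hu
  · rw [h_of_zero hu] at hlt
    rw [hu, cSol_zero_left, sSol_zero_left]
    have h1 : |1 - 2 * l| ^ 2 = 1 / 2 := by rw [sq_abs]; linarith
    have h2 : |1 - 2 * l| * √2 = 1 := by
      have : (|1 - 2 * l| * √2) ^ 2 = 1 := by
        rw [mul_pow, h1, Real.sq_sqrt (by norm_num)]; norm_num
      nlinarith [mul_nonneg hd.le (Real.sqrt_nonneg 2)]
    nlinarith
  · obtain ⟨w, hw, hu⟩ := exists_pos_of_eq_sq hu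
    obtain ⟨_, hq⟩ := quot_mem_Ioo hl hw hu
    rw [h_of_pos hw hu, lt_div_iff₀ hw, mul_comm] at hlt
    rw [hu, cSol_pos, sSol_pos hw.ne']
    have h1 : Real.tanh (w * t) < 2 * w / |1 - 2 * l| := by
      by_contra! hle
      refine absurd (Real.artanh_le_artanh hq.1 (Real.tanh_lt_one _) hle) ?_
      rw [Real.artanh_tanh]
      exact not_le.mpr hlt
    rw [lt_div_iff₀ hd] at h1
    have h2 := mul_lt_mul_of_pos_right h1 (Real.cosh_pos (w * t))
    have h3 := tanh_mul_cosh (w * t)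
    rw [sub_pos, div_mul_div_comm, div_lt_iff₀ (by positivity), ← h3]
    linarith
  · have hu' : ∃ w ≠ 0, 8 * l ^ 2 - 8 * l + 1 = -4 * w ^ 2 := by
      obtain ⟨w, hw, hu⟩ := hu; exact ⟨w, hw, by linarith⟩
    obtain ⟨w, hw, hu⟩ := exists_pos_of_eq_sq hu'
    rw [neg_mul] at hu
    rw [h_of_neg hhalf hw hu, lt_div_iff₀ hw, mul_comm] at hlt
    rw [hu, cSol_neg, sSol_neg hw.ne']
    have hlt2 := hlt.trans (Real.arctan_lt_pi_div_two _)
    have h0 : 0 ≤ w * t := by positivity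
    have hcos : 0 < Real.cos (w * t) :=
      Real.cos_pos_of_mem_Ioo ⟨by linarith [Real.pi_pos], hlt2⟩
    have h1 : Real.tan (w * t) < 2 * w / |1 - 2 * l| := by
      rw [← Real.tan_arctan (2 * w / |1 - 2 * l|)]
      exact Real.tan_lt_tan_of_lt_of_lt_pi_div_two (by linarith [Real.pi_pos])
        (Real.arctan_lt_pi_div_two _) hlt
    rw [lt_div_iff₀ hd] at h1
    have h2 := mul_lt_mul_of_pos_right h1 hcos
    have h3 := Real.tan_mul_cos hcos.ne'
    rw [sub_pos, div_mul_div_comm, div_lt_iff₀ (by positivity), ← h3]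
    linarith

/-- In the trigonometric case the denominator can become positive again after its first zero. Since
`w ≤ 1/2`, the bound `t ≤ 2.8` keeps `w t` below `π / 2`; also `2.8` is below `2√2` and `π`, the
values of `h` in the two exceptional cases. -/
theorem le_h_of_riccatiDen_pos {l t : ℝ} (hl : l ∈ Ioo (0 : ℝ) 1) (ht : 0 ≤ t) (ht2 : t ≤ 2.8)
    (hD : 0 < riccatiDen |1 - 2 * l| t) : t ≤ h l := by
  by_cases hhalf : l = 1 / 2
  · subst hhalf
    rw [h_half]; linarith [Real.pi_gt_three]
  have hd : 0 < |1 - 2 * l| := abs_pos.mpr fun h0 => hhalf (by linarith)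
  rw [riccatiDen, two_mul_sq_abs_sub_one] at hD
  rcases eq_sq_or (8 * l ^ 2 - 8 * l + 1) with hu | hu | hu
  · rw [h_of_zero hu]
    have : (1.4 : ℝ) ≤ √2 := Real.le_sqrt_of_sq_le (by norm_num)
    linarith
  · obtain ⟨w, hw, hu⟩ := exists_pos_of_eq_sq hu
    obtain ⟨_, hq⟩ := quot_mem_Ioo hl hw hu
    rw [h_of_pos hw hu, le_div_iff₀ hw, mul_comm, ← Real.artanh_tanh (w * t)]
    rw [hu, cSol_pos, sSol_pos hw.ne', sub_pos, div_mul_div_comm, div_lt_iff₀ (by positivity),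
      ← tanh_mul_cosh] at hD
    have h1 : Real.tanh (w * t) ≤ 2 * w / |1 - 2 * l| := by
      rw [le_div_iff₀ hd]
      by_contra! hlt
      have := mul_lt_mul_of_pos_right hlt (Real.cosh_pos (w * t))
      linarith
    exact Real.artanh_le_artanh (Real.neg_one_lt_tanh _) hq.2 h1
  · have hu' : ∃ w ≠ 0, 8 * l ^ 2 - 8 * l + 1 = -4 * w ^ 2 := by
      obtain ⟨w, hw, hu⟩ := hu; exact ⟨w, hw, by linarith⟩
    obtain ⟨w, hw, hu⟩ := exists_pos_of_eq_sq hu'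
    rw [neg_mul] at hu
    have hw2 : w ≤ 1 / 2 := by nlinarith [sq_nonneg (1 - 2 * l)]
    have h0 : 0 ≤ w * t := by positivity
    have h4 : w * t < Real.pi / 2 := by nlinarith [Real.pi_gt_three]
    have hcos : 0 < Real.cos (w * t) :=
      Real.cos_pos_of_mem_Ioo ⟨by linarith [Real.pi_pos], h4⟩
    rw [h_of_neg hhalf hw hu, le_div_iff₀ hw, mul_comm,
      ← Real.arctan_tan (by linarith [Real.pi_pos]) h4]
    rw [hu, cSol_neg, sSol_neg hw.ne', sub_pos, div_mul_div_comm, div_lt_iff₀ (by positivity),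
      ← Real.tan_mul_cos hcos.ne'] at hD
    apply Real.arctan_mono
    rw [le_div_iff₀ hd]
    by_contra! hlt
    have := mul_lt_mul_of_pos_right hlt hcos
    linarith

theorem h_nonneg {l : ℝ} (hl : l ∈ Ioo (0 : ℝ) 1) : 0 ≤ h l := by
  refine le_h_of_riccatiDen_pos hl le_rfl (by norm_num) ?_
  have h1 : coshSqrt 0 = 1 := by simpa using coshSqrt_sq 0
  simp [riccatiDen, cSol, sSol, h1]

theorem C₁_le {l : ℝ} (hl : l ∈ Ioo (0 : ℝ) 1) : C₁ ≤ h l :=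
  csInf_le ⟨0, by rintro _ ⟨l, hl, rfl⟩; exact h_nonneg hl⟩ ⟨l, hl, rfl⟩

/-- The value `d = 1` corresponds to the endpoints `0` and `1` left out of the infimum; there the
denominator is `exp (-t/2)` and has no zero. -/
theorem riccatiDen_pos {d t : ℝ} (hd : d ∈ Icc (0 : ℝ) 1) (ht : 0 ≤ t) (hlt : t < C₁) :
    0 < riccatiDen d t := by
  rcases hd.2.eq_or_lt with rfl | hd1
  · rw [riccatiDen_one]; exact Real.exp_pos _
  · have hl : (1 - d) / 2 ∈ Ioo (0 : ℝ) 1 := ⟨by linarith, by linarith [hd.1]⟩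
    have := riccatiDen_pos_of_lt hl ht (hlt.trans_le (C₁_le hl))
    rwa [show 1 - 2 * ((1 - d) / 2) = d by ring, abs_of_nonneg hd.1] at this

/-- The uniform bound for the geometric series over alternating words. -/
theorem exists_bound {x y : ℝ} (hx : 0 ≤ x) (hy : 0 ≤ y) (hxy : x + y < C₁) :
    ∃ B : ℝ, ∀ d ∈ Icc (0 : ℝ) 1, ∀ a b : ℝ, 0 ≤ a → 0 ≤ b →
      a * riccatiDen d x ≤ sSol (2 * d ^ 2 - 1) x → b * riccatiDen d y ≤ sSol (2 * d ^ 2 - 1) y →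
      (1 - d ^ 2) / 4 * (a * b) < 1 ∧
        (1 + a) * (1 + b) ≤ B * (1 - (1 - d ^ 2) / 4 * (a * b)) := by
  -- This is `(1 + r(x)) (1 + r(y)) / (1 - (1 - d²)/4 * r(x) r(y))` for the exact solution `r`, with
  -- denominators cleared by the addition formula; a bound for it on the compact interval serves as
  -- `B`.
  have hcont : ContinuousOn (fun d : ℝ => (riccatiDen d x + sSol (2 * d ^ 2 - 1) x) *
      (riccatiDen d y + sSol (2 * d ^ 2 - 1) y) / riccatiDen d (x + y)) (Icc 0 1) := by
    refine ContinuousOn.div ?_ (continuous_riccatiDen_left _).continuousOn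
      fun d hd => (riccatiDen_pos hd (by positivity) hxy).ne'
    exact (((continuous_riccatiDen_left x).add (continuous_sSol_left x)).mul
      ((continuous_riccatiDen_left y).add (continuous_sSol_left y))).continuousOn
  obtain ⟨B, hB⟩ := isCompact_Icc.exists_bound_of_continuousOn hcont
  refine ⟨B, fun d hd a b ha hb hax hby => ?_⟩
  have hDx := riccatiDen_pos hd hx (by linarith)
  have hDy := riccatiDen_pos hd hy (by linarith)
  have hDxy := riccatiDen_pos hd (add_nonneg hx hy) hxy
  have hadd := riccatiDen_add d x y
  have hc : 0 ≤ (1 - d ^ 2) / 4 := by nlinarith [hd.1, hd.2]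
  have hBd := (le_abs_self _).trans (hB d hd)
  set Dx := riccatiDen d x
  set Dy := riccatiDen d y
  set Sx := sSol (2 * d ^ 2 - 1) x
  set Sy := sSol (2 * d ^ 2 - 1) y
  rw [div_le_iff₀ hDxy] at hBd
  have h1 : (a * Dx) * (b * Dy) ≤ Sx * Sy :=
    mul_le_mul hax hby (by positivity) ((mul_nonneg ha hDx.le).trans hax)
  have h2 : riccatiDen d (x + y) ≤ Dx * Dy * (1 - (1 - d ^ 2) / 4 * (a * b)) := by
    have := mul_le_mul_of_nonneg_left h1 hc
    linarith
  have hDD : 0 < Dx * Dy := mul_pos hDx hDy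
  refine ⟨?_, ?_⟩
  · have := (mul_pos_iff_of_pos_left hDD).mp (hDxy.trans_le h2)
    linarith
  · have h3 : ((1 + a) * Dx) * ((1 + b) * Dy) ≤ (Dx + Sx) * (Dy + Sy) :=
      mul_le_mul (by linarith) (by linarith) (by positivity) (by nlinarith [mul_nonneg ha hDx.le])
    have hB0 : 0 ≤ B := (norm_nonneg _).trans (hB d hd)
    have h4 := mul_le_mul_of_nonneg_left h2 hB0
    refine le_of_mul_le_mul_left ?_ hDD
    linarith

end Radius

end
end BCH


/-! ### Numerical enclosure of `C₁`. -/

namespace BCH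
noncomputable section

open Set Filter Topology

section Numerics

theorem hasSum_tail_bound :
    HasSum (fun k : ℕ => 2 ^ 6 / ((12 ! : ℕ) : ℝ) * (2 ^ k / (k ! : ℕ)))
      (2 ^ 6 / ((12 ! : ℕ) : ℝ) * Real.exp 2) := by
  refine HasSum.mul_left _ ?_
  rw [Real.exp_eq_exp_ℝ]
  exact NormedSpace.expSeries_div_hasSum_exp (2 : ℝ)

theorem tail_bound_le : 2 ^ 6 / ((12 ! : ℕ) : ℝ) * Real.exp 2 ≤ 1 / 1000000 := by
  have h1 : Real.exp 2 = Real.exp 1 ^ 2 := by rw [← Real.exp_nat_mul]; norm_num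
  have h2 : Real.exp 2 ≤ 2.7182818286 ^ 2 := by
    rw [h1]; exact pow_le_pow_left₀ (Real.exp_pos 1).le Real.exp_one_lt_d9.le 2
  have h3 : ((12 ! : ℕ) : ℝ) = 479001600 := by norm_num [Nat.factorial]
  rw [h3]
  norm_num at h2 ⊢
  linarith

/-- Six terms are kept in each series. Since `12! * k!` divides `(12 + k)!`, the neglected terms are
dominated by an exponential series with sum `2⁶ e² / 12!`, just below `10⁻⁶`. -/
theorem pow_div_factorial_le {v : ℝ} (hv : |v| ≤ 2) {n k : ℕ} (hn : k + 12 ≤ n) :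
    ‖v ^ (k + 6) / ((n ! : ℕ) : ℝ)‖ ≤ 2 ^ 6 / ((12 ! : ℕ) : ℝ) * (2 ^ k / (k ! : ℕ)) := by
  rw [norm_div, norm_pow, Real.norm_eq_abs, Real.norm_natCast, div_mul_div_comm, ← pow_add,
    ← Nat.cast_mul]
  have h1 : 12 ! * k ! ≤ n ! :=
    (Nat.le_of_dvd (Nat.factorial_pos _) (Nat.factorial_mul_factorial_dvd_factorial_add 12 k)).trans
      (Nat.factorial_le (by omega))
  have h2 : 0 < 12 ! * k ! := by positivity
  rw [add_comm 6 k]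
  gcongr

theorem abs_coshSqrt_sub_le {v : ℝ} (hv : |v| ≤ 2) :
    |coshSqrt v - ∑ k ∈ Finset.range 6, v ^ k / ((2 * k)! : ℕ)| ≤ 1 / 1000000 := by
  rw [coshSqrt, ← (summable_coshSqrt v).sum_add_tsum_nat_add 6, add_sub_cancel_left,
    ← Real.norm_eq_abs]
  exact (tsum_of_norm_bounded hasSum_tail_bound
    fun k => pow_div_factorial_le hv (by omega)).trans tail_bound_le

theorem abs_sinhcSqrt_sub_le {v : ℝ} (hv : |v| ≤ 2) :
    |sinhcSqrt v - ∑ k ∈ Finset.range 6, v ^ k / ((2 * k + 1)! : ℕ)| ≤ 1 / 1000000 := by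
  rw [sinhcSqrt, ← (summable_sinhcSqrt v).sum_add_tsum_nat_add 6, add_sub_cancel_left,
    ← Real.norm_eq_abs]
  exact (tsum_of_norm_bounded hasSum_tail_bound
    fun k => pow_div_factorial_le hv (by omega)).trans tail_bound_le

theorem abs_riccati_arg_le {d t : ℝ} (hd : d ∈ Icc (0 : ℝ) 1) (ht : 0 ≤ t) (ht2 : t ≤ 2.8) :
    |(2 * d ^ 2 - 1) * t ^ 2 / 4| ≤ 2 := by
  have h1 : |2 * d ^ 2 - 1| ≤ 1 := abs_le.mpr ⟨by nlinarith [hd.1], by nlinarith [hd.1, hd.2]⟩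
  have h2 : t ^ 2 ≤ 8 := by nlinarith
  rw [abs_div, abs_mul, abs_of_nonneg (sq_nonneg t), abs_of_pos (by norm_num : (0 : ℝ) < 4),
    div_le_iff₀ (by norm_num)]
  nlinarith [abs_nonneg (2 * d ^ 2 - 1), sq_nonneg t]

theorem riccatiDen_pos_of_le {d : ℝ} (hd : d ∈ Icc (0 : ℝ) 1) : 0 < riccatiDen d 2.7014 := by
  have hv := abs_riccati_arg_le hd (t := 2.7014) (by norm_num) (by norm_num)
  have h1 := (abs_le.mp (abs_coshSqrt_sub_le hv)).1
  have h2 := (abs_le.mp (abs_sinhcSqrt_sub_le hv)).2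
  have h3 := mul_le_mul_of_nonneg_left h2 (mul_nonneg hd.1 (by norm_num : (0 : ℝ) ≤ 2.7014 / 2))
  obtain ⟨hd0, hd1⟩ := hd
  rw [riccatiDen, cSol, sSol]
  set c := coshSqrt ((2 * d ^ 2 - 1) * 2.7014 ^ 2 / 4)
  set s := sinhcSqrt ((2 * d ^ 2 - 1) * 2.7014 ^ 2 / 4)
  simp only [Finset.sum_range_succ, Finset.sum_range_zero, Nat.factorial] at h1 h3
  -- After truncation the claim is positivity of a polynomial of degree `11` in `d` on `[0, 1]`,
  -- with small margin near `d = 0.48251`. The certificate is a nonnegative combination of these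
  -- multiples of `(d - 0.48251)²`.
  have e : ∀ k : ℕ, 0 ≤ (d - 0.48251) ^ 2 * d ^ k := fun k => by positivity
  have e' : ∀ k : ℕ, 0 ≤ (d - 0.48251) ^ 2 * (1 - d ^ k) := fun k =>
    mul_nonneg (sq_nonneg _) (sub_nonneg.mpr (pow_le_one₀ hd0 hd1))
  have e0 := e 0
  have e2 := e 2
  have e4 := e 4
  have e6 := e 6
  have e8 := e 8
  have o1 := e' 1
  have o3 := e' 3
  have o5 := e' 5
  have o7 := e' 7
  have o9 := e' 9
  norm_num at h1 h3 e0 e2 e4 e6 e8 o1 o3 o5 o7 o9 ⊢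
  linarith

theorem riccatiDen_neg : riccatiDen 0.4825 2.70149 < 0 := by
  have hv := abs_riccati_arg_le (d := 0.4825) (t := 2.70149) (by norm_num) (by norm_num) (by norm_num)
  have h1 := (abs_le.mp (abs_coshSqrt_sub_le hv)).2
  have h2 := (abs_le.mp (abs_sinhcSqrt_sub_le hv)).1
  rw [riccatiDen, cSol, sSol]
  set c := coshSqrt ((2 * 0.4825 ^ 2 - 1) * 2.70149 ^ 2 / 4)
  set s := sinhcSqrt ((2 * 0.4825 ^ 2 - 1) * 2.70149 ^ 2 / 4)
  simp only [Finset.sum_range_succ, Finset.sum_range_zero, Nat.factorial] at h1 h2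
  norm_num at h1 h2 ⊢
  linarith

theorem C₁_bounds : 2.7014 ≤ C₁ ∧ C₁ < 2.7015 := by
  constructor
  · refine le_csInf ((nonempty_Ioo.mpr zero_lt_one).image _) ?_
    rintro _ ⟨l, hl, rfl⟩
    refine le_h_of_riccatiDen_pos hl (by norm_num) (by norm_num) (riccatiDen_pos_of_le ⟨abs_nonneg _, ?_⟩)
    rw [abs_le]; constructor <;> linarith [hl.1, hl.2]
  -- This `l` gives `|1 - 2l| = 0.4825`, close to the point used in the lower bound.
  · have hl : (0.25875 : ℝ) ∈ Ioo (0 : ℝ) 1 := by constructor <;> norm_num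
    refine ((C₁_le hl).trans ?_).trans_lt (by norm_num : (2.70149 : ℝ) < 2.7015)
    by_contra! hlt
    have h1 := riccatiDen_pos_of_lt hl (by norm_num) hlt
    rw [show |1 - 2 * (0.25875 : ℝ)| = 0.4825 by norm_num [abs_of_pos]] at h1
    exact h1.not_gt riccatiDen_neg

end Numerics

end
end BCH


/-! ### Words and weighted coefficient sums. -/

namespace BCH
noncomputable section

open Finset.HasAntidiagonal (antidiagonal mem_antidiagonal)
open MvPowerSeries (coeff coeff_mul)

section Words

variable (K : Type*) [Field K]

/-- The basis of words of the free associative algebra. -/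
def wordBasis : Module.Basis (FreeMonoid (Fin 2)) K (FreeAlgebra K (Fin 2)) :=
  FreeAlgebra.basisFreeMonoid K (Fin 2)

theorem wordBasis_apply (w : FreeMonoid (Fin 2)) :
    wordBasis K w = FreeMonoid.lift (FreeAlgebra.ι K) w := by
  simp [wordBasis, FreeAlgebra.basisFreeMonoid, FreeAlgebra.equivMonoidAlgebraFreeMonoid]

theorem wordBasis_one : wordBasis K 1 = 1 := by rw [wordBasis_apply, map_one]

theorem wordBasis_mul (v w : FreeMonoid (Fin 2)) :
    wordBasis K (v * w) = wordBasis K v * wordBasis K w := by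
  simp only [wordBasis_apply, map_mul]

theorem wordBasis_of (i : Fin 2) : wordBasis K (FreeMonoid.of i) = FreeAlgebra.ι K i := by
  rw [wordBasis_apply, FreeMonoid.lift_eval_of]

variable {K}

theorem sum_repr_smul_word (f : FreeAlgebra K (Fin 2)) :
    ((wordBasis K).repr f).sum (fun w c => c • wordBasis K w) = f :=
  (wordBasis K).linearCombination_repr f

end Words

section L1

variable {K : Type*} [RCLike K]

/-- The sum of the absolute values of the coefficients of a noncommutative polynomial. -/
def l1Norm (f : FreeAlgebra K (Fin 2)) : ℝ := ((wordBasis K).repr f).sum fun _ c => ‖c‖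

theorem l1Norm_nonneg (f : FreeAlgebra K (Fin 2)) : 0 ≤ l1Norm f :=
  Finset.sum_nonneg fun _ _ => norm_nonneg _

theorem l1Norm_eq_sum {f : FreeAlgebra K (Fin 2)} {s : Finset (FreeMonoid (Fin 2))}
    (hs : ((wordBasis K).repr f).support ⊆ s) :
    l1Norm f = ∑ w ∈ s, ‖(wordBasis K).repr f w‖ :=
  Finsupp.sum_of_support_subset _ hs _ (by simp)

theorem sum_le_l1Norm (f : FreeAlgebra K (Fin 2)) (s : Finset (FreeMonoid (Fin 2))) :
    ∑ w ∈ s, ‖(wordBasis K).repr f w‖ ≤ l1Norm f := by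
  classical
  rw [l1Norm_eq_sum (f := f) (s := s ∪ ((wordBasis K).repr f).support) Finset.subset_union_right]
  exact Finset.sum_le_sum_of_subset_of_nonneg Finset.subset_union_left fun _ _ _ => norm_nonneg _

theorem l1Norm_zero : l1Norm (0 : FreeAlgebra K (Fin 2)) = 0 := by simp [l1Norm]

theorem l1Norm_add_le (f g : FreeAlgebra K (Fin 2)) : l1Norm (f + g) ≤ l1Norm f + l1Norm g := by
  rw [l1Norm, map_add]
  refine (Finset.sum_le_sum fun w _ => (norm_add_le _ _)).trans ?_
  rw [Finset.sum_add_distrib]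
  exact add_le_add (sum_le_l1Norm f _) (sum_le_l1Norm g _)

theorem l1Norm_smul_le (r : K) (f : FreeAlgebra K (Fin 2)) :
    l1Norm (r • f) ≤ ‖r‖ * l1Norm f := by
  rw [l1Norm, map_smul]
  simp only [Finsupp.sum, Finsupp.smul_apply, smul_eq_mul, norm_mul]
  rw [← Finset.mul_sum]
  exact mul_le_mul_of_nonneg_left (sum_le_l1Norm f _) (norm_nonneg _)

theorem l1Norm_word (w : FreeMonoid (Fin 2)) : l1Norm (wordBasis K w) = 1 := by
  simp [l1Norm]

theorem l1Norm_one : l1Norm (1 : FreeAlgebra K (Fin 2)) = 1 := by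
  rw [← wordBasis_one, l1Norm_word]

theorem l1Norm_sum_le {ι : Type*} (s : Finset ι) (f : ι → FreeAlgebra K (Fin 2)) :
    l1Norm (∑ i ∈ s, f i) ≤ ∑ i ∈ s, l1Norm (f i) :=
  Finset.le_sum_of_subadditive _ l1Norm_zero.le l1Norm_add_le _ _

theorem l1Norm_mul_le (f g : FreeAlgebra K (Fin 2)) : l1Norm (f * g) ≤ l1Norm f * l1Norm g := by
  conv_lhs => rw [← sum_repr_smul_word f, ← sum_repr_smul_word g, Finsupp.sum, Finsupp.sum, Finset.sum_mul_sum]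
  conv_rhs => rw [l1Norm, l1Norm, Finsupp.sum, Finsupp.sum, Finset.sum_mul_sum]
  refine (l1Norm_sum_le _ _).trans (Finset.sum_le_sum fun v _ => ?_)
  refine (l1Norm_sum_le _ _).trans (Finset.sum_le_sum fun w _ => ?_)
  rw [smul_mul_smul_comm, ← wordBasis_mul]
  refine (l1Norm_smul_le _ _).trans ?_
  rw [l1Norm_word, mul_one, norm_mul]

theorem l1Norm_ι_pow (i : Fin 2) (n : ℕ) : l1Norm (FreeAlgebra.ι K i ^ n) = 1 := by
  have : FreeAlgebra.ι K i ^ n = wordBasis K (FreeMonoid.of i ^ n) := by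
    rw [wordBasis_apply, map_pow, FreeMonoid.lift_eval_of]
  rw [this, l1Norm_word]

/-- The weight `x ^ p * y ^ q` of a bidegree. -/
def wt (x y : ℝ) (m : Fin 2 →₀ ℕ) : ℝ := x ^ m 0 * y ^ m 1

theorem wt_add (x y : ℝ) (m n : Fin 2 →₀ ℕ) : wt x y (m + n) = wt x y m * wt x y n := by
  simp only [wt, Finsupp.add_apply, pow_add]; ring

theorem wt_nonneg {x y : ℝ} (hx : 0 ≤ x) (hy : 0 ≤ y) (m : Fin 2 →₀ ℕ) : 0 ≤ wt x y m :=
  mul_nonneg (pow_nonneg hx _) (pow_nonneg hy _)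

/-- The weighted sum of the absolute values of the coefficients of a formal series, over the
bidegrees up to `M`. -/
def truncNorm (x y : ℝ) (M : Fin 2 →₀ ℕ) (F : Ser K) : ℝ :=
  ∑ m ∈ Finset.Iic M, l1Norm (coeff m F) * wt x y m

theorem truncNorm_nonneg {x y : ℝ} (hx : 0 ≤ x) (hy : 0 ≤ y) (M : Fin 2 →₀ ℕ)
    (F : Ser K) : 0 ≤ truncNorm x y M F :=
  Finset.sum_nonneg fun _ _ => mul_nonneg (l1Norm_nonneg _) (wt_nonneg hx hy _)

theorem truncNorm_add_le {x y : ℝ} (hx : 0 ≤ x) (hy : 0 ≤ y) (M : Fin 2 →₀ ℕ)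
    (F G : Ser K) :
    truncNorm x y M (F + G) ≤ truncNorm x y M F + truncNorm x y M G := by
  rw [truncNorm, truncNorm, truncNorm, ← Finset.sum_add_distrib]
  refine Finset.sum_le_sum fun m _ => ?_
  rw [← add_mul, map_add]
  exact mul_le_mul_of_nonneg_right (l1Norm_add_le _ _) (wt_nonneg hx hy _)

theorem truncNorm_smul_le {x y : ℝ} (hx : 0 ≤ x) (hy : 0 ≤ y) (M : Fin 2 →₀ ℕ)
    (r : K) (F : Ser K) :
    truncNorm x y M (r • F) ≤ ‖r‖ * truncNorm x y M F := by
  rw [truncNorm, truncNorm, Finset.mul_sum]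
  refine Finset.sum_le_sum fun m _ => ?_
  rw [← mul_assoc]
  exact mul_le_mul_of_nonneg_right (l1Norm_smul_le _ _) (wt_nonneg hx hy _)

theorem truncNorm_sub_le {x y : ℝ} (hx : 0 ≤ x) (hy : 0 ≤ y) (M : Fin 2 →₀ ℕ)
    (F G : Ser K) :
    truncNorm x y M (F - G) ≤ truncNorm x y M F + truncNorm x y M G := by
  have h := truncNorm_smul_le hx hy M (-1) G
  rw [norm_neg, norm_one, one_mul, neg_smul, one_smul] at h
  rw [sub_eq_add_neg]
  exact (truncNorm_add_le hx hy M _ _).trans (by linarith)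

theorem truncNorm_one_le (x y : ℝ) (M : Fin 2 →₀ ℕ) : truncNorm x y M (1 : Ser K) ≤ 1 := by
  classical
  rw [truncNorm, Finset.sum_eq_single 0]
  · simp [l1Norm_one, wt]
  · intro m _ hm
    rw [MvPowerSeries.coeff_one, if_neg hm, l1Norm_zero, zero_mul]
  · simp

/-- The box `Iic M` is closed under passing to smaller bidegrees, so every splitting of a bidegree
in it stays in it, and a pair of bidegrees determines its sum. All sums are finite, so no
convergence enters. -/
theorem truncNorm_mul_le {x y : ℝ} (hx : 0 ≤ x) (hy : 0 ≤ y) (M : Fin 2 →₀ ℕ)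
    (F G : Ser K) :
    truncNorm x y M (F * G) ≤ truncNorm x y M F * truncNorm x y M G := by
  classical
  have h1 : ∀ m, l1Norm (coeff m (F * G)) * wt x y m ≤ ∑ p ∈ antidiagonal m,
      (l1Norm (coeff p.1 F) * wt x y p.1) * (l1Norm (coeff p.2 G) * wt x y p.2) := by
    intro m
    rw [coeff_mul]
    refine (mul_le_mul_of_nonneg_right (l1Norm_sum_le _ _) (wt_nonneg hx hy _)).trans ?_
    rw [Finset.sum_mul]
    refine Finset.sum_le_sum fun p hp => ?_
    rw [← mem_antidiagonal.mp hp, wt_add, mul_mul_mul_comm]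
    exact mul_le_mul_of_nonneg_right (l1Norm_mul_le _ _)
      (mul_nonneg (wt_nonneg hx hy _) (wt_nonneg hx hy _))
  refine (Finset.sum_le_sum fun m _ => h1 m).trans ?_
  rw [truncNorm, truncNorm, Finset.sum_mul_sum, ← Finset.sum_product', Finset.sum_sigma']
  have hinj : Set.InjOn (fun q : (Σ _ : Fin 2 →₀ ℕ, (Fin 2 →₀ ℕ) × (Fin 2 →₀ ℕ)) => q.2)
      ((Finset.Iic M).sigma fun i => antidiagonal i) := by
    rintro ⟨i, p⟩ hp ⟨i', p'⟩ hp' rfl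
    simp only [Finset.coe_sigma, Set.mem_sigma_iff, Finset.mem_coe, mem_antidiagonal] at hp hp'
    rw [Sigma.mk.injEq]
    exact ⟨hp.2.symm.trans hp'.2, HEq.rfl⟩
  rw [← Finset.sum_image (f := fun p : (Fin 2 →₀ ℕ) × (Fin 2 →₀ ℕ) =>
    (l1Norm (coeff p.1 F) * wt x y p.1) * (l1Norm (coeff p.2 G) * wt x y p.2)) hinj]
  refine Finset.sum_le_sum_of_subset_of_nonneg ?_ fun p _ _ =>
    mul_nonneg (mul_nonneg (l1Norm_nonneg _) (wt_nonneg hx hy _))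
      (mul_nonneg (l1Norm_nonneg _) (wt_nonneg hx hy _))
  intro p hp
  simp only [Finset.mem_image, Finset.mem_sigma, Finset.mem_Iic, mem_antidiagonal,
    Finset.mem_product] at hp ⊢
  obtain ⟨q, ⟨hq1, hq2⟩, rfl⟩ := hp
  rw [← hq2] at hq1
  exact ⟨le_self_add.trans hq1, le_add_self.trans hq1⟩

theorem wt_single (x y : ℝ) (i : Fin 2) (n : ℕ) :
    wt x y (Finsupp.single i n) = (![x, y] i) ^ n := by
  fin_cases i <;> simp [wt]

theorem truncNorm_ser_le {x y : ℝ} (hx : 0 ≤ x) (hy : 0 ≤ y) (M : Fin 2 →₀ ℕ)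
    (i : Fin 2) (g : PowerSeries K) :
    truncNorm x y M (ser i g) ≤
      ∑ n ∈ Finset.range (M i + 1), ‖PowerSeries.coeff n g‖ * (![x, y] i) ^ n := by
  classical
  have h1 : ∑ n ∈ Finset.range (M i + 1), l1Norm (coeff (Finsupp.single i n) (ser i g)) *
      wt x y (Finsupp.single i n) = truncNorm x y M (ser i g) := by
    refine Finset.sum_of_injOn (fun n => Finsupp.single i n)
      ((Finsupp.single_injective i).injOn) ?_ ?_ fun _ _ => rfl
    · intro n hn
      simp only [Finset.coe_Iic, Set.mem_Iic, Finset.mem_coe, Finset.mem_range] at hn ⊢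
      exact Finsupp.single_le_iff.mpr (by omega)
    · intro m hm hn
      rw [coeff_ser, if_neg, l1Norm_zero, zero_mul]
      intro h
      have := Finset.mem_Iic.mp hm i
      exact hn ⟨m i, by simpa using by omega, h.symm⟩
  rw [← h1]
  refine Finset.sum_le_sum fun n _ => ?_
  rw [wt_single, coeff_ser_single]
  refine mul_le_mul_of_nonneg_right ?_ (pow_nonneg (by fin_cases i <;> simpa) _)
  refine (l1Norm_smul_le _ _).trans ?_
  rw [l1Norm_ι_pow, mul_one]

end L1

end
end BCH


/-! ### The resolvent of `exp X * exp Y - 1`. -/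

namespace BCH
noncomputable section

open Finset.HasAntidiagonal (antidiagonal mem_antidiagonal)
open MvPowerSeries (coeff coeff_mul)

section Resolvent

section OneVariable

variable {K : Type*} [Field K] [CharZero K] (s : K)

/-- The series `1 - s + s * exp`. -/
def resDen : PowerSeries K := PowerSeries.C (1 - s) + PowerSeries.C s * PowerSeries.exp K

/-- The series `(exp - 1) / (1 - s + s * exp)`. -/
def resSeries : PowerSeries K := (PowerSeries.exp K - 1) * (resDen s)⁻¹

theorem constantCoeff_resDen : PowerSeries.constantCoeff (resDen s) = 1 := by simp [resDen]

theorem resDen_mul_inv : resDen s * (resDen s)⁻¹ = 1 :=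
  PowerSeries.mul_inv_cancel _ (by simp [constantCoeff_resDen])

theorem one_sub_resSeries : 1 - PowerSeries.C s * resSeries s = (resDen s)⁻¹ := by
  have h := resDen_mul_inv s
  have e : resDen s = 1 + PowerSeries.C s * (PowerSeries.exp K - 1) := by
    rw [resDen, map_sub, map_one]; ring
  rw [resSeries]
  rw [e] at h ⊢
  linear_combination -h

theorem one_add_resSeries :
    1 + PowerSeries.C (1 - s) * resSeries s = PowerSeries.exp K * (resDen s)⁻¹ := by
  have h := one_sub_resSeries s
  rw [map_sub, map_one]
  rw [resSeries] at h ⊢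
  linear_combination h

/-- The derivative is `exp / (1 - s + s exp)²`, which factors as `(1 + (1 - s) a)(1 - s a)` for `a =
resSeries s`. -/
theorem derivative_resSeries : PowerSeries.derivative K (resSeries s) =
    1 + PowerSeries.C (1 - 2 * s) * resSeries s -
      PowerSeries.C (s * (1 - s)) * (resSeries s * resSeries s) := by
  have h1 := one_sub_resSeries s
  have h2 := one_add_resSeries s
  have h3 : PowerSeries.derivative K (resSeries s) =
      (PowerSeries.exp K * (resDen s)⁻¹) * (1 - PowerSeries.C s * resSeries s) := by
    rw [resSeries, Derivation.leibniz, PowerSeries.derivative_inv', map_sub,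
      PowerSeries.derivative_exp, resDen, map_add, Derivation.leibniz, PowerSeries.derivative_exp]
    simp only [PowerSeries.derivative_C, PowerSeries.derivative_one, smul_eq_mul]
    ring
  rw [h3, ← h2]
  simp only [map_sub, map_mul, map_one, map_ofNat]
  ring

theorem coeff_zero_resSeries : PowerSeries.coeff 0 (resSeries s) = 0 := by simp [resSeries]

theorem coeff_succ_resSeries (i : ℕ) :
    PowerSeries.coeff (i + 1) (resSeries s) * (i + 1) =
      (if i = 0 then 1 else 0) + (1 - 2 * s) * PowerSeries.coeff i (resSeries s) -
        s * (1 - s) * ∑ p ∈ antidiagonal i,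
          PowerSeries.coeff p.1 (resSeries s) * PowerSeries.coeff p.2 (resSeries s) := by
  rw [← PowerSeries.coeff_derivative, derivative_resSeries, map_sub, map_add,
    PowerSeries.coeff_C_mul, PowerSeries.coeff_C_mul, PowerSeries.coeff_mul,
    PowerSeries.coeff_one]

end OneVariable

section Majorant

variable {K : Type*} [RCLike K]

/-- Absolute values turn `1 - 2s` into `d = |1 - 2s|` and flip the sign of the quadratic term, whose
coefficient is `s (1 - s) = (1 - d²) / 4`. -/
theorem norm_coeff_succ_resSeries_le {s : ℝ} (hs : s ∈ Set.Icc (0 : ℝ) 1) (i : ℕ) :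
    (i + 1) * ‖PowerSeries.coeff (i + 1) (resSeries (s : K))‖ ≤
      (if i = 0 then 1 else 0) + |1 - 2 * s| * ‖PowerSeries.coeff i (resSeries (s : K))‖ +
        (1 - |1 - 2 * s| ^ 2) / 4 * ∑ p ∈ antidiagonal i,
          ‖PowerSeries.coeff p.1 (resSeries (s : K))‖ *
            ‖PowerSeries.coeff p.2 (resSeries (s : K))‖ := by
  have h := congrArg norm (coeff_succ_resSeries (s : K) i)
  have h1 : ‖((i : K) + 1)‖ = i + 1 := by
    rw [← Nat.cast_succ, RCLike.norm_natCast, Nat.cast_succ]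
  rw [norm_mul, h1, mul_comm] at h
  rw [h]
  refine (norm_sub_le _ _).trans (add_le_add ((norm_add_le _ _).trans (add_le_add ?_ ?_)) ?_)
  · split_ifs <;> simp
  · rw [norm_mul]
    refine mul_le_mul_of_nonneg_right (le_of_eq ?_) (norm_nonneg _)
    rw [show (1 - 2 * (s : K)) = ((1 - 2 * s : ℝ) : K) by push_cast; ring, RCLike.norm_ofReal]
  · rw [norm_mul]
    refine mul_le_mul (le_of_eq ?_) ((norm_sum_le _ _).trans (Finset.sum_le_sum fun p _ => ?_))
      (norm_nonneg _) ?_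
    · rw [show ((s : K) * (1 - (s : K))) = ((s * (1 - s) : ℝ) : K) by push_cast; ring,
        RCLike.norm_ofReal, abs_of_nonneg (mul_nonneg hs.1 (by linarith [hs.2])), sq_abs]
      ring
    · rw [norm_mul]
    · rw [sq_abs]; nlinarith [hs.1, hs.2]

theorem abs_one_sub_mem {s : ℝ} (hs : s ∈ Set.Icc (0 : ℝ) 1) :
    |1 - 2 * s| ∈ Set.Icc (0 : ℝ) 1 :=
  ⟨abs_nonneg _, abs_le.mpr ⟨by linarith [hs.2], by linarith [hs.1]⟩⟩

theorem sum_norm_resSeries_mul_le {s t : ℝ} (hs : s ∈ Set.Icc (0 : ℝ) 1) (ht : 0 ≤ t)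
    (hlt : t < C₁) (N : ℕ) :
    (∑ i ∈ Finset.range (N + 1), ‖PowerSeries.coeff i (resSeries (s : K))‖ * t ^ i) *
      riccatiDen |1 - 2 * s| t ≤ sSol (2 * |1 - 2 * s| ^ 2 - 1) t :=
  sum_mul_riccatiDen_le (abs_one_sub_mem hs) ht
    (fun _ hr => (riccatiDen_pos (abs_one_sub_mem hs) hr.1 (hr.2.trans_lt hlt)).le)
    (fun _ => norm_nonneg _) (by rw [coeff_zero_resSeries, norm_zero])
    (norm_coeff_succ_resSeries_le hs) N

end Majorant

section TwoVariables

variable {K : Type*} [Field K] [CharZero K] (s : K)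

theorem ser_C_mul {K : Type*} [Field K] (i : Fin 2) (r : K) (g : PowerSeries K) :
    ser i (PowerSeries.C r * g) = r • ser i g := by
  rw [← PowerSeries.smul_eq_C_mul, ser_smul]

/-- The product `(1 - s a) (1 + s U) (1 - s b)`, which is `1 + s (1 - s) a b`. -/
theorem conj_expProd :
    ser 0 (resDen s)⁻¹ * (1 + s • (expProd K - 1)) * ser 1 (resDen s)⁻¹ =
      1 + (s * (1 - s)) • (ser 0 (resSeries s) * ser 1 (resSeries s)) := by
  have h1 : ∀ i, ser i (resDen s)⁻¹ = 1 - s • ser i (resSeries s) := fun i => by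
    rw [← one_sub_resSeries, ser_sub, ser_one, ser_C_mul]
  have h2 : ∀ i, ser i (PowerSeries.exp K) * ser i (resDen s)⁻¹ =
      1 + (1 - s) • ser i (resSeries s) := fun i => by
    rw [← ser_mul, ← one_add_resSeries, ser_add, ser_one, ser_C_mul]
  have h3 : ser 0 (resDen s)⁻¹ * ser 0 (PowerSeries.exp K) =
      1 + (1 - s) • ser 0 (resSeries s) := by
    rw [← h2, ← ser_mul, ← ser_mul, mul_comm]
  have h4 : ser 0 (resDen s)⁻¹ * (1 + s • (expProd K - 1)) * ser 1 (resDen s)⁻¹ =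
      (1 - s) • (ser 0 (resDen s)⁻¹ * ser 1 (resDen s)⁻¹) +
        s • ((ser 0 (resDen s)⁻¹ * ser 0 (PowerSeries.exp K)) *
          (ser 1 (PowerSeries.exp K) * ser 1 (resDen s)⁻¹)) := by
    rw [expProd, expX_eq_ser, expY_eq_ser]
    simp only [mul_add, add_mul, mul_sub, sub_mul, smul_sub, sub_smul, mul_smul_comm,
      smul_mul_assoc, mul_one, one_smul, mul_assoc]
    abel
  rw [h4, h3, h2, h1, h1]
  simp only [mul_add, add_mul, mul_sub, sub_mul, mul_smul_comm, smul_mul_assoc, mul_one, one_mul,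
    smul_add, smul_sub, smul_smul]
  module

/-- The inverse of `1 + s (1 - s) a b`. -/
def altInv : Ser K :=
  MvPowerSeries.invOfUnit (1 + (s * (1 - s)) • (ser 0 (resSeries s) * ser 1 (resSeries s))) 1

theorem constantCoeff_alt : MvPowerSeries.constantCoeff
    (1 + (s * (1 - s)) • (ser 0 (resSeries s) * ser 1 (resSeries s))) =
      ((1 : (FreeAlgebra K (Fin 2))ˣ) : FreeAlgebra K (Fin 2)) := by
  have h : MvPowerSeries.constantCoeff (ser 0 (resSeries s)) = 0 := by
    rw [← MvPowerSeries.coeff_zero_eq_constantCoeff_apply, coeff_ser]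
    simp [coeff_zero_resSeries]
  have h2 : ∀ (r : K) (F : Ser K), MvPowerSeries.constantCoeff (r • F) =
      r • MvPowerSeries.constantCoeff F := fun _ _ => rfl
  rw [map_add, map_one, h2, map_mul, h]
  simp

theorem alt_mul_altInv :
    (1 + (s * (1 - s)) • (ser 0 (resSeries s) * ser 1 (resSeries s))) * altInv s = 1 :=
  MvPowerSeries.mul_invOfUnit _ _ (constantCoeff_alt s)

/-- The inverse of `1 + s U`, where `U = exp X * exp Y - 1`. -/
def resInv : Ser K := ser 1 (resDen s)⁻¹ * altInv s * ser 0 (resDen s)⁻¹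

theorem mul_resInv : (1 + s • (expProd K - 1)) * resInv s = 1 := by
  have h : ∀ i, ser i (resDen s) * ser i (resDen s)⁻¹ = 1 := fun i => by
    rw [← ser_mul, resDen_mul_inv, ser_one]
  have h1 := alt_mul_altInv s
  rw [← conj_expProd] at h1
  calc (1 + s • (expProd K - 1)) * resInv s
      = (ser 0 (resDen s) * ser 0 (resDen s)⁻¹) * ((1 + s • (expProd K - 1)) * resInv s) := by
        rw [h, one_mul]
    _ = ser 0 (resDen s) * (ser 0 (resDen s)⁻¹ * (1 + s • (expProd K - 1)) * ser 1 (resDen s)⁻¹ *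
          altInv s) * ser 0 (resDen s)⁻¹ := by simp only [resInv, mul_assoc]
    _ = 1 := by rw [h1, mul_one, h]

/-- The truncated resolvent series. -/
def resTrunc (N : ℕ) : Ser K :=
  ∑ k ∈ Finset.range N, (-s) ^ k • (expProd K - 1) ^ (k + 1)

/-- The remainder of the geometric sum is a multiple of `U ^ (N + 1) * resInv s`, of order at least
`N + 1`. -/
theorem coeff_resTrunc {N : ℕ} {m : Fin 2 →₀ ℕ} (hm : m.degree ≤ N) :
    coeff m (resTrunc s N) = coeff m ((expProd K - 1) * resInv s) := by
  have hU : (expProd K - 1) ∈ ordFilt K 1 :=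
    mem_ordFilt_one (by rw [map_sub, coeff_zero_expProd]; simp)
  have hUp : ∀ n, (expProd K - 1) ^ n ∈ ordFilt K n := fun n => by
    induction n with
    | zero => exact mem_ordFilt_zero _
    | succ n ih => rw [pow_succ]; exact mul_mem_ordFilt ih hU
  have h1 : resTrunc s N = (expProd K - 1) * ∑ k ∈ Finset.range N, (-(s • (expProd K - 1))) ^ k := by
    rw [resTrunc, Finset.mul_sum]
    refine Finset.sum_congr rfl fun k _ => ?_
    rw [← neg_smul, smul_pow, mul_smul_comm, pow_succ']
  have h2 := geom_sum_mul_neg (-(s • (expProd K - 1))) N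
  rw [sub_neg_eq_add] at h2
  have h3 : (∑ k ∈ Finset.range N, (-(s • (expProd K - 1))) ^ k) =
      (1 - (-(s • (expProd K - 1))) ^ N) * resInv s := by
    rw [← h2, mul_assoc, mul_resInv, mul_one]
  have h4 : resTrunc s N - (expProd K - 1) * resInv s =
      - ((-s) ^ N • ((expProd K - 1) ^ (N + 1) * resInv s)) := by
    rw [h1, h3, ← neg_smul s, smul_pow, pow_succ' _ N]
    simp only [sub_mul _ _ (resInv s), mul_sub, one_mul, smul_mul_assoc, mul_smul_comm, mul_assoc]
    abel
  have h5 : resTrunc s N - (expProd K - 1) * resInv s ∈ ordFilt K (N + 1) := by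
    rw [h4]
    exact neg_mem (Submodule.smul_mem _ _ (mul_mem_ordFilt (b := 0) (hUp _) (mem_ordFilt_zero _)))
  have h6 := h5 m (by omega)
  rwa [map_sub, sub_eq_zero] at h6

end TwoVariables

end Resolvent

end
end BCH


/-! ### Uniform resolvent bound and integration over `s`. -/

namespace BCH
noncomputable section

open Finset.HasAntidiagonal (antidiagonal mem_antidiagonal)
open MvPowerSeries (coeff coeff_mul)

section Bound

variable {K : Type*} [RCLike K]

theorem truncNorm_expProd_sub_one_le {x y : ℝ} (hx : 0 ≤ x) (hy : 0 ≤ y) (M : Fin 2 →₀ ℕ) :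
    truncNorm x y M (expProd K - 1) ≤ Real.exp x * Real.exp y + 1 := by
  have hz : ∀ i : Fin 2, 0 ≤ (![x, y] i) := fun i => by fin_cases i <;> simpa
  have h : ∀ i : Fin 2, truncNorm x y M (ser i (PowerSeries.exp K)) ≤ Real.exp (![x, y] i) := by
    intro i
    refine (truncNorm_ser_le hx hy M i _).trans ?_
    refine le_trans (le_of_eq (Finset.sum_congr rfl fun n _ => ?_))
      (Real.sum_le_exp_of_nonneg (hz i) (M i + 1))
    rw [coeff_exp_field, norm_inv, RCLike.norm_natCast]
    ring
  refine (truncNorm_sub_le hx hy M _ _).trans (add_le_add ?_ (truncNorm_one_le x y M))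
  rw [expProd, expX_eq_ser, expY_eq_ser]
  exact (truncNorm_mul_le hx hy M _ _).trans
    (mul_le_mul (h 0) (h 1) (truncNorm_nonneg hx hy M _) (Real.exp_pos _).le)

theorem exists_truncNorm_resolvent_le {x y : ℝ} (hx : 0 ≤ x) (hy : 0 ≤ y) (hxy : x + y < C₁) :
    ∃ B : ℝ, ∀ s ∈ Set.Icc (0 : ℝ) 1, ∀ M : Fin 2 →₀ ℕ,
      truncNorm x y M ((expProd K - 1) * resInv (s : K)) ≤ B := by
  obtain ⟨B, hB⟩ := exists_bound hx hy hxy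
  refine ⟨(Real.exp x * Real.exp y + 1) * B, fun s hs M => ?_⟩
  refine (truncNorm_mul_le hx hy M _ _).trans ?_
  refine mul_le_mul (truncNorm_expProd_sub_one_le hx hy M) ?_ (truncNorm_nonneg hx hy M _)
    (by positivity)
  set a := ∑ n ∈ Finset.range (M 0 + 1), ‖PowerSeries.coeff n (resSeries (s : K))‖ * x ^ n
  set b := ∑ n ∈ Finset.range (M 1 + 1), ‖PowerSeries.coeff n (resSeries (s : K))‖ * y ^ n
  have ha : 0 ≤ a := Finset.sum_nonneg fun _ _ => mul_nonneg (norm_nonneg _) (pow_nonneg hx _)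
  have hb : 0 ≤ b := Finset.sum_nonneg fun _ _ => mul_nonneg (norm_nonneg _) (pow_nonneg hy _)
  obtain ⟨h1, h2⟩ := hB _ (abs_one_sub_mem hs) a b ha hb
    (sum_norm_resSeries_mul_le hs hx (by linarith) _)
    (sum_norm_resSeries_mul_le hs hy (by linarith) _)
  have hc : (1 - |1 - 2 * s| ^ 2) / 4 = s * (1 - s) := by rw [sq_abs]; ring
  rw [hc] at h1 h2
  have hc0 : 0 ≤ s * (1 - s) := mul_nonneg hs.1 (by linarith [hs.2])
  have hna : truncNorm x y M (ser 0 (resSeries (s : K))) ≤ a := truncNorm_ser_le hx hy M 0 _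
  have hnb : truncNorm x y M (ser 1 (resSeries (s : K))) ≤ b := truncNorm_ser_le hx hy M 1 _
  have hs1 : ‖(s : K)‖ ≤ 1 := by rw [RCLike.norm_ofReal, abs_of_nonneg hs.1]; exact hs.2
  have hinv : ∀ i c, truncNorm x y M (ser i (resSeries (s : K))) ≤ c →
      truncNorm x y M (ser i (resDen (s : K))⁻¹) ≤ 1 + c := by
    intro i c hic
    rw [← one_sub_resSeries, ser_sub, ser_one, ser_C_mul]
    refine (truncNorm_sub_le hx hy M _ _).trans (add_le_add (truncNorm_one_le x y M) ?_)
    refine (truncNorm_smul_le hx hy M _ _).trans ?_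
    exact (mul_le_of_le_one_left (truncNorm_nonneg hx hy M _) hs1).trans hic
  set J := truncNorm x y M (altInv (s : K))
  have hJ0 : 0 ≤ J := truncNorm_nonneg hx hy M _
  -- The geometric series is summed implicitly: `J` is a finite real number and its factor on the
  -- right is below `1`, so the term can be absorbed on the left.
  have hJ : J ≤ 1 + s * (1 - s) * (a * b) * J := by
    have h3 : altInv (s : K) = 1 - ((s : K) * (1 - (s : K))) •
        (ser 0 (resSeries (s : K)) * ser 1 (resSeries (s : K)) * altInv (s : K)) := by
      have := alt_mul_altInv (s : K)
      rw [add_mul, one_mul, smul_mul_assoc] at this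
      exact eq_sub_of_add_eq this
    have h4 : J ≤ 1 + ‖((s : K) * (1 - (s : K)))‖ * (truncNorm x y M
        (ser 0 (resSeries (s : K)) * ser 1 (resSeries (s : K)) * altInv (s : K))) := by
      refine (le_of_eq (congrArg (truncNorm x y M) h3)).trans
        ((truncNorm_sub_le hx hy M _ _).trans (add_le_add (truncNorm_one_le x y M)
          (truncNorm_smul_le hx hy M _ _)))
    rw [show ((s : K) * (1 - (s : K))) = ((s * (1 - s) : ℝ) : K) by push_cast; ring,
      RCLike.norm_ofReal, abs_of_nonneg hc0] at h4
    refine h4.trans (add_le_add le_rfl ?_)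
    rw [mul_assoc (s * (1 - s)) (a * b) J]
    refine mul_le_mul_of_nonneg_left ?_ hc0
    refine (truncNorm_mul_le hx hy M _ _).trans (mul_le_mul_of_nonneg_right ?_ hJ0)
    exact (truncNorm_mul_le hx hy M _ _).trans
      (mul_le_mul hna hnb (truncNorm_nonneg hx hy M _) ha)
  have h5 : truncNorm x y M (resInv (s : K)) ≤ (1 + b) * J * (1 + a) := by
    refine (truncNorm_mul_le hx hy M _ _).trans ?_
    refine mul_le_mul ?_ (hinv 0 a hna) (truncNorm_nonneg hx hy M _) (by positivity)
    exact (truncNorm_mul_le hx hy M _ _).trans (mul_le_mul_of_nonneg_right (hinv 1 b hnb) hJ0)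
  have h6 : 0 < 1 - s * (1 - s) * (a * b) := by linarith
  have h7 : J * (1 - s * (1 - s) * (a * b)) ≤ 1 := by linarith
  have hB0 : 0 ≤ B := by
    by_contra! hneg
    have : 0 < (1 + a) * (1 + b) := by positivity
    nlinarith
  calc truncNorm x y M (resInv (s : K)) ≤ (1 + b) * J * (1 + a) := h5
    _ = ((1 + a) * (1 + b)) * J := by ring
    _ ≤ (B * (1 - s * (1 - s) * (a * b))) * J := mul_le_mul_of_nonneg_right h2 hJ0
    _ = B * (J * (1 - s * (1 - s) * (a * b))) := by ring
    _ ≤ B := mul_le_of_le_one_right hB0 h7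

theorem repr_resTrunc (s : ℝ) (m : Fin 2 →₀ ℕ) (w : FreeMonoid (Fin 2)) (N : ℕ) :
    (wordBasis K).repr (coeff m (resTrunc (s : K) N)) w = ∑ k ∈ Finset.range N,
      ((-s) ^ k : ℝ) • (wordBasis K).repr (coeff m ((expProd K - 1) ^ (k + 1))) w := by
  rw [resTrunc, map_sum, map_sum, Finsupp.finsetSum_apply]
  refine Finset.sum_congr rfl fun k _ => ?_
  change (wordBasis K).repr ((-(s : K)) ^ k • coeff m ((expProd K - 1) ^ (k + 1))) w = _
  rw [map_smul, Finsupp.smul_apply, RCLike.real_smul_eq_coe_mul, smul_eq_mul]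
  push_cast
  rfl

/-- This is `log (1 + U) = ∫ U (1 + sU)⁻¹ ds` for a single coefficient, where it reduces to `∫ (-s)ᵏ
ds = (-1)ᵏ / (k + 1)`. -/
theorem repr_bchAssoc (p q : ℕ) (w : FreeMonoid (Fin 2)) :
    (wordBasis K).repr (bchAssoc K p q) w =
      ∫ s in (0 : ℝ)..1, (wordBasis K).repr (coeff (expo p q) (resTrunc (s : K) (p + q))) w := by
  simp only [repr_resTrunc]
  rw [intervalIntegral.integral_finsetSum fun k _ => Continuous.intervalIntegrable (by fun_prop) _ _]
  have h1 : bchAssoc K p q = ∑ k ∈ Finset.range (p + q), ((-1 : K) ^ k / ((k + 1 : ℕ) : K)) •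
      coeff (expo p q) ((expProd K - 1) ^ (k + 1)) := by
    rw [bchAssoc, ← Finset.Ico_add_one_right_eq_Icc, Finset.sum_Ico_eq_sum_range,
      Nat.add_sub_cancel]
    refine Finset.sum_congr rfl fun k _ => ?_
    rw [add_comm 1 k, pow_succ, pow_succ, mul_assoc]
    simp [expProd]
  rw [h1, map_sum, Finsupp.finsetSum_apply]
  refine Finset.sum_congr rfl fun k _ => ?_
  rw [intervalIntegral.integral_smul_const, map_smul, Finsupp.smul_apply,
    RCLike.real_smul_eq_coe_mul, smul_eq_mul]
  congr 1
  have h2 : ∫ s in (0 : ℝ)..1, (-s) ^ k = (-1) ^ k / (k + 1) := by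
    rw [funext fun s : ℝ => neg_pow s k]
    rw [intervalIntegral.integral_const_mul, integral_pow]
    simp [div_eq_mul_inv]
  rw [h2]
  push_cast
  rfl

/-- The coefficients of the Baker-Campbell-Hausdorff series, as an associative series, are
summable with weights `x ^ p * y ^ q` for `x + y < C₁`. -/
theorem exists_sum_l1Norm_bchAssoc_le {x y : ℝ} (hx : 0 ≤ x) (hy : 0 ≤ y) (hxy : x + y < C₁) :
    ∃ B : ℝ, ∀ M : Fin 2 →₀ ℕ,
      ∑ m ∈ Finset.Iic M, l1Norm (bchAssoc K (m 0) (m 1)) * wt x y m ≤ B := by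
  obtain ⟨B, hB⟩ := exists_truncNorm_resolvent_le (K := K) hx hy hxy
  refine ⟨B, fun M => ?_⟩
  have hexpo : ∀ m : Fin 2 →₀ ℕ, expo (m 0) (m 1) = m := fun m => by
    ext i; fin_cases i <;> simp [expo]
  have hdeg : ∀ m : Fin 2 →₀ ℕ, m.degree = m 0 + m 1 := fun m => by simp [Finsupp.degree_eq_sum]
  set ph : (Fin 2 →₀ ℕ) → FreeMonoid (Fin 2) → ℝ → ℝ := fun m w s =>
    ‖(wordBasis K).repr (coeff m (resTrunc (s : K) (m 0 + m 1))) w‖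
  have hph : ∀ m w, Continuous (ph m w) := fun m w => by
    simp only [ph, repr_resTrunc]; fun_prop
  -- A finite set of words independent of `s`, so that sum and integral can be exchanged; discarding
  -- other words of the resolvent only helps the upper bound.
  set S : (Fin 2 →₀ ℕ) → Finset (FreeMonoid (Fin 2)) := fun m =>
    ((wordBasis K).repr (bchAssoc K (m 0) (m 1))).support
  have h1 : ∀ m, l1Norm (bchAssoc K (m 0) (m 1)) ≤ ∫ s in (0 : ℝ)..1, ∑ w ∈ S m, ph m w s := by
    intro m
    rw [intervalIntegral.integral_finsetSum fun w _ => (hph m w).intervalIntegrable _ _]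
    refine Finset.sum_le_sum fun w _ => ?_
    rw [repr_bchAssoc, hexpo]
    exact intervalIntegral.norm_integral_le_integral_norm zero_le_one
  have hterm : ∀ m, Continuous fun s => (∑ w ∈ S m, ph m w s) * wt x y m := fun m =>
    (continuous_finsetSum _ fun w _ => hph m w).mul continuous_const
  have hcont : Continuous fun s => ∑ m ∈ Finset.Iic M, (∑ w ∈ S m, ph m w s) * wt x y m :=
    continuous_finsetSum _ fun m _ => hterm m
  calc ∑ m ∈ Finset.Iic M, l1Norm (bchAssoc K (m 0) (m 1)) * wt x y m
      ≤ ∑ m ∈ Finset.Iic M, (∫ s in (0 : ℝ)..1, ∑ w ∈ S m, ph m w s) * wt x y m :=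
        Finset.sum_le_sum fun m _ => mul_le_mul_of_nonneg_right (h1 m) (wt_nonneg hx hy m)
    _ = ∫ s in (0 : ℝ)..1, ∑ m ∈ Finset.Iic M, (∑ w ∈ S m, ph m w s) * wt x y m := by
        rw [intervalIntegral.integral_finsetSum fun m _ => (hterm m).intervalIntegrable _ _]
        exact Finset.sum_congr rfl fun m _ => (intervalIntegral.integral_mul_const _ _).symm
    _ ≤ ∫ _ in (0 : ℝ)..1, B := by
        refine intervalIntegral.integral_mono_on zero_le_one (hcont.intervalIntegrable _ _)
          intervalIntegrable_const fun s hs => ?_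
        refine le_trans (Finset.sum_le_sum fun m _ => ?_) (hB s hs M)
        refine mul_le_mul_of_nonneg_right ?_ (wt_nonneg hx hy m)
        simp only [ph]
        -- The truncation order depends on `m`; it is replaced here by the one resolvent to which
        -- the uniform bound applies.
        rw [coeff_resTrunc (s : K) (hdeg m).le]
        exact sum_le_l1Norm _ _
    _ = B := by simp

theorem summable_l1Norm_bchAssoc {x y : ℝ} (hx : 0 ≤ x) (hy : 0 ≤ y) (hxy : x + y < C₁) :
    Summable fun pq : ℕ × ℕ => l1Norm (bchAssoc K pq.1 pq.2) * x ^ pq.1 * y ^ pq.2 := by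
  classical
  obtain ⟨B, hB⟩ := exists_sum_l1Norm_bchAssoc_le (K := K) hx hy hxy
  refine summable_of_sum_le (c := B) (fun pq => by have := l1Norm_nonneg (bchAssoc K pq.1 pq.2); positivity)
    fun u => ?_
  have hinj : Function.Injective fun pq : ℕ × ℕ => expo pq.1 pq.2 := by
    intro a b h
    have h0 := DFunLike.congr_fun h 0
    have h1 := DFunLike.congr_fun h 1
    simp [expo] at h0 h1
    exact Prod.ext h0 h1
  -- The sum of finitely many bidegrees is an upper bound for each of them.
  refine le_trans ?_ (hB (∑ m ∈ u.image fun pq => expo pq.1 pq.2, m))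
  have h2 : ∑ pq ∈ u, l1Norm (bchAssoc K pq.1 pq.2) * x ^ pq.1 * y ^ pq.2 =
      ∑ m ∈ u.image fun pq => expo pq.1 pq.2, l1Norm (bchAssoc K (m 0) (m 1)) * wt x y m := by
    rw [Finset.sum_image hinj.injOn]
    refine Finset.sum_congr rfl fun pq _ => ?_
    simp [expo, wt, mul_assoc]
  rw [h2]
  refine Finset.sum_le_sum_of_subset_of_nonneg (fun m hm => ?_)
    fun m _ _ => mul_nonneg (l1Norm_nonneg _) (wt_nonneg hx hy m)
  rw [Finset.mem_Iic]
  exact Finset.single_le_sum (f := fun m => m) (fun _ _ => zero_le) hm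

end Bound

end
end BCH


/-! ### Bidegrees of words. -/

namespace BCH
noncomputable section

open Finset.HasAntidiagonal (antidiagonal mem_antidiagonal)
open MvPowerSeries (coeff coeff_mul)

section Bidegree

/-- The bidegree of a word. -/
def wordDeg (w : FreeMonoid (Fin 2)) : Fin 2 →₀ ℕ :=
  (FreeMonoid.lift (fun i => Multiplicative.ofAdd (Finsupp.single i 1)) w :
    Multiplicative (Fin 2 →₀ ℕ)).toAdd

theorem wordDeg_one : wordDeg 1 = 0 := rfl

theorem wordDeg_of (i : Fin 2) : wordDeg (FreeMonoid.of i) = Finsupp.single i 1 := rfl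

theorem wordDeg_mul (v w : FreeMonoid (Fin 2)) : wordDeg (v * w) = wordDeg v + wordDeg w := by
  simp [wordDeg]

variable (K : Type*) [Field K]

/-- The noncommutative polynomials of bidegree `m`. -/
def homPart (m : Fin 2 →₀ ℕ) : Submodule K (FreeAlgebra K (Fin 2)) :=
  Submodule.span K (wordBasis K '' {w | wordDeg w = m})

variable {K}

theorem wordDeg_eq_of_mem_support {m : Fin 2 →₀ ℕ} {f : FreeAlgebra K (Fin 2)}
    (hf : f ∈ homPart K m) {w : FreeMonoid (Fin 2)} (hw : w ∈ ((wordBasis K).repr f).support) :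
    wordDeg w = m :=
  (wordBasis K).mem_span_image.mp hf hw

theorem wordBasis_mem_homPart (w : FreeMonoid (Fin 2)) : wordBasis K w ∈ homPart K (wordDeg w) :=
  Submodule.subset_span ⟨w, rfl, rfl⟩

theorem one_mem_homPart : (1 : FreeAlgebra K (Fin 2)) ∈ homPart K 0 := by
  simpa only [wordBasis_one, wordDeg_one] using wordBasis_mem_homPart (K := K) 1

theorem mul_mem_homPart {m n : Fin 2 →₀ ℕ} {f g : FreeAlgebra K (Fin 2)}
    (hf : f ∈ homPart K m) (hg : g ∈ homPart K n) : f * g ∈ homPart K (m + n) := by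
  have h : homPart K m * homPart K n ≤ homPart K (m + n) := by
    rw [homPart, homPart, Submodule.span_mul_span, Submodule.span_le]
    rintro _ ⟨_, ⟨v, rfl, rfl⟩, _, ⟨w, rfl, rfl⟩, rfl⟩
    change wordBasis K v * wordBasis K w ∈ homPart K (wordDeg v + wordDeg w)
    rw [← wordBasis_mul, ← wordDeg_mul]
    exact wordBasis_mem_homPart _
  exact h (Submodule.mul_mem_mul hf hg)

theorem ι_pow_mem_homPart (i : Fin 2) (n : ℕ) :
    FreeAlgebra.ι K i ^ n ∈ homPart K (Finsupp.single i n) := by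
  induction n with
  | zero => simpa using one_mem_homPart
  | succ n ih =>
    rw [pow_succ, Finsupp.single_add]
    refine mul_mem_homPart ih ?_
    rw [← wordBasis_of, ← wordDeg_of]
    exact wordBasis_mem_homPart _

variable (K) in
/-- The formal series whose coefficient at each bidegree has that bidegree. -/
def homSeries : Subalgebra K (Ser K) where
  carrier := {F | ∀ m, coeff m F ∈ homPart K m}
  mul_mem' {F G} hF hG m := by
    rw [coeff_mul]
    refine Submodule.sum_mem _ fun p hp => ?_
    rw [← mem_antidiagonal.mp hp]
    exact mul_mem_homPart (hF _) (hG _)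
  add_mem' {F G} hF hG m := by
    rw [map_add]
    exact add_mem (hF m) (hG m)
  algebraMap_mem' r m := by
    classical
    rw [Algebra.algebraMap_eq_smul_one]
    change r • coeff m (1 : Ser K) ∈ homPart K m
    refine Submodule.smul_mem _ _ ?_
    rw [MvPowerSeries.coeff_one]
    split_ifs with h
    · exact h ▸ one_mem_homPart
    · exact zero_mem _

theorem ser_mem_homSeries (i : Fin 2) (g : PowerSeries K) : ser i g ∈ homSeries K := by
  intro m
  rw [coeff_ser]
  split_ifs with h
  · refine Submodule.smul_mem _ _ ?_
    have := ι_pow_mem_homPart (K := K) i (m i)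
    rwa [← h] at this
  · exact zero_mem _

theorem bchAssoc_mem_homPart [CharZero K] (p q : ℕ) : bchAssoc K p q ∈ homPart K (expo p q) := by
  refine Submodule.sum_mem _ fun k _ => Submodule.smul_mem _ _ ?_
  have h : (expX K * expY K - 1) ^ k ∈ homSeries K := by
    rw [expX_eq_ser, expY_eq_ser]
    exact pow_mem (sub_mem (mul_mem (ser_mem_homSeries _ _) (ser_mem_homSeries _ _))
      (one_mem _)) k
  exact h _

end Bidegree

/-! ### Right-nested presentations and the bound for `gammaCoeff`. -/

section Monomials

/-- The right-nested bracketing of a nonempty word. -/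
def nest : List (Fin 2) → FreeMagma (Fin 2)
  -- An arbitrary value; the empty word has bidegree `0` and does not occur in the parts with `p + q
  -- > 0`.
  | [] => .of 0
  | [i] => .of i
  | i :: j :: l => .mul (.of i) (nest (j :: l))

variable (K : Type*) [Field K]

theorem aug_word_mul (i : Fin 2) (w : FreeMonoid (Fin 2)) :
    aug K (wordBasis K (FreeMonoid.of i * w)) = 0 := by
  rw [wordBasis_mul, wordBasis_of, map_mul, aug_ι, zero_mul]

theorem dynkin_word_cons (i j : Fin 2) (w : FreeMonoid (Fin 2)) :
    dynkin K (wordBasis K (FreeMonoid.of i * (FreeMonoid.of j * w))) =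
      ⁅FreeLieAlgebra.of K i, dynkin K (wordBasis K (FreeMonoid.of j * w))⁆ := by
  rw [wordBasis_mul K (FreeMonoid.of i), wordBasis_of, dynkin_ι_mul, aug_word_mul, zero_smul,
    add_zero]

theorem dynkin_word_of (i : Fin 2) :
    dynkin K (wordBasis K (FreeMonoid.of i)) = FreeLieAlgebra.of K i := by
  rw [wordBasis_of, dynkin_ι]

theorem lieMonomial_nest (l : List (Fin 2)) (hl : l ≠ []) :
    lieMonomial (nest l) = dynkin ℝ (wordBasis ℝ (FreeMonoid.ofList l)) := by
  induction l with
  | nil => exact absurd rfl hl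
  | cons i l ih =>
    cases l with
    | nil => exact (dynkin_word_of ℝ i).symm
    | cons j l =>
      refine Eq.trans ?_ (dynkin_word_cons ℝ i j (FreeMonoid.ofList l)).symm
      exact congrArg (fun P => ⁅FreeLieAlgebra.of ℝ i, P⁆) (ih (by simp))

theorem degIn_nest (k : Fin 2) (l : List (Fin 2)) (hl : l ≠ []) :
    degIn k (nest l) = wordDeg (FreeMonoid.ofList l) k := by
  induction l with
  | nil => exact absurd rfl hl
  | cons i l ih =>
    rw [FreeMonoid.ofList_cons, wordDeg_mul, Finsupp.add_apply, wordDeg_of, Finsupp.single_apply]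
    cases l with
    | nil => rfl
    | cons j l => rw [← ih (by simp)]; rfl

/-- The right-nested presentation of the bidegree `(p, q)` part of the BCH series, obtained from its
commutator expansion by the Dynkin map, bounds `gammaCoeff p q`. -/
theorem gammaCoeff_le (p q : ℕ) :
    gammaCoeff p q ≤ ENNReal.ofReal (l1Norm (bchAssoc ℝ p q)) := by
  classical
  rcases Nat.eq_zero_or_pos (p + q) with h0 | hpos
  · obtain ⟨rfl, rfl⟩ : p = 0 ∧ q = 0 := by omega
    refine iInf₂_le_of_le 0 ⟨by simp, ?_⟩ (by simp)
    rw [bchLie_eq, bchAssoc_zero]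
    simp
  set f := (wordBasis ℝ).repr (bchAssoc ℝ p q)
  set θ : FreeMagma (Fin 2) →₀ ℝ := ∑ w ∈ f.support,
    Finsupp.single (nest w.toList) (((p + q : ℕ) : ℝ)⁻¹ * f w)
  have hdeg : ∀ w ∈ f.support, wordDeg w = expo p q := fun w hw =>
    wordDeg_eq_of_mem_support (bchAssoc_mem_homPart p q) hw
  have hne : ∀ w ∈ f.support, w.toList ≠ [] := by
    intro w hw h
    have hw1 : w = 1 := h
    have h1 := hdeg w hw
    rw [hw1, wordDeg_one] at h1
    have h2 := DFunLike.congr_fun h1 0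
    have h3 := DFunLike.congr_fun h1 1
    simp [expo] at h2 h3
    omega
  have hθ : IsPresentation p q θ := by
    refine ⟨fun γ hγ => ?_, ?_⟩
    · obtain ⟨w, hw, hγw⟩ := Finset.mem_biUnion.mp (Finsupp.support_finsetSum hγ)
      obtain rfl := Finset.mem_singleton.mp (Finsupp.support_single_subset hγw)
      rw [degIn_nest _ _ (hne w hw), degIn_nest _ _ (hne w hw), FreeMonoid.ofList_toList, hdeg w hw]
      simp [expo]
    · rw [← Finsupp.sum_finsetSum_index (by simp) (by simp [add_smul]), bchLie_eq]
      conv_rhs => rw [← sum_repr_smul_word (bchAssoc ℝ p q)]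
      rw [Finsupp.sum, map_sum, Finset.smul_sum]
      refine Finset.sum_congr rfl fun w hw => ?_
      rw [Finsupp.sum_single_index (by simp), lieMonomial_nest _ (hne w hw),
        FreeMonoid.ofList_toList, map_smul, smul_smul]
  refine iInf₂_le_of_le θ hθ ?_
  rw [Finsupp.sum, ← ENNReal.ofReal_sum_of_nonneg fun _ _ => abs_nonneg _]
  refine ENNReal.ofReal_le_ofReal ?_
  -- The triangle inequality over words makes it irrelevant whether different words yield the same
  -- bracketing.
  calc ∑ γ ∈ θ.support, |θ γ|
      ≤ ∑ γ ∈ θ.support, ∑ w ∈ f.support,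
          |Finsupp.single (nest w.toList) (((p + q : ℕ) : ℝ)⁻¹ * f w) γ| := by
        refine Finset.sum_le_sum fun γ _ => ?_
        simp only [θ, Finsupp.finsetSum_apply]
        exact Finset.abs_sum_le_sum_abs _ _
    _ = ∑ w ∈ f.support, ∑ γ ∈ θ.support,
          |Finsupp.single (nest w.toList) (((p + q : ℕ) : ℝ)⁻¹ * f w) γ| := Finset.sum_comm
    _ ≤ ∑ w ∈ f.support, |f w| := by
        refine Finset.sum_le_sum fun w _ => ?_
        -- The gain `1 / (p + q)` from the Dynkin map is not needed and is dropped.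
        have h1 : |((p + q : ℕ) : ℝ)⁻¹ * f w| ≤ |f w| := by
          rw [abs_mul]
          refine mul_le_of_le_one_left (abs_nonneg _) ?_
          rw [abs_inv, Nat.abs_cast]
          exact inv_le_one_of_one_le₀ (by exact_mod_cast hpos)
        simp only [Finsupp.single_apply, apply_ite abs, abs_zero, Finset.sum_ite_eq]
        split_ifs
        exacts [h1, abs_nonneg _]
    _ = l1Norm (bchAssoc ℝ p q) := rfl

end Monomials

/-! ### Evaluation in normed Lie algebras and convergence. -/

section Evaluation

variable {𝕜 : Type*} {𝔤 : Type*} [RCLike 𝕜] [NormedLieRing 𝔤] [NormedLieAlgebra 𝕜 𝔤]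

theorem norm_lift_dynkin_word_le (X Y : 𝔤) (w : FreeMonoid (Fin 2)) :
    ‖FreeLieAlgebra.lift 𝕜 ![X, Y] (dynkin 𝕜 (wordBasis 𝕜 w))‖ ≤ wt ‖X‖ ‖Y‖ (wordDeg w) := by
  have hof : ∀ i : Fin 2, ‖(![X, Y] i : 𝔤)‖ = wt ‖X‖ ‖Y‖ (wordDeg (FreeMonoid.of i)) := by
    intro i
    rw [wordDeg_of, wt_single, pow_one]
    fin_cases i <;> rfl
  induction w using FreeMonoid.inductionOn' with
  | one =>
    rw [wordBasis_one, dynkin_one, map_zero, norm_zero]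
    exact wt_nonneg (norm_nonneg _) (norm_nonneg _) _
  | of_mul i w ih =>
    cases w using FreeMonoid.casesOn with
    | one => rw [mul_one, dynkin_word_of, FreeLieAlgebra.lift_of_apply, hof]
    | of_mul j w =>
      rw [dynkin_word_cons, LieHom.map_lie, FreeLieAlgebra.lift_of_apply, wordDeg_mul, wt_add,
        ← hof]
      exact (NormedLieRing.norm_lie_le _ _).trans (mul_le_mul_of_nonneg_left ih (norm_nonneg _))

/-- The Dynkin formula is applied over `𝕜` itself, so the real presentations behind `gammaCoeff`
need not be transferred to `𝕜`. -/
theorem norm_bchPart_le (X Y : 𝔤) (p q : ℕ) :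
    ‖bchPart 𝕜 X Y p q‖ ≤ l1Norm (bchAssoc 𝕜 p q) * ‖X‖ ^ p * ‖Y‖ ^ q := by
  rcases Nat.eq_zero_or_pos (p + q) with h0 | hpos
  · obtain ⟨rfl, rfl⟩ : p = 0 ∧ q = 0 := by omega
    rw [bchPart, bchLie_eq, bchAssoc_zero]
    simp [l1Norm_zero]
  have hinv : ‖((p + q : ℕ) : 𝕜)⁻¹‖ ≤ 1 := by
    rw [norm_inv, RCLike.norm_natCast]
    exact inv_le_one_of_one_le₀ (by exact_mod_cast hpos)
  rw [bchPart, bchLie_eq, map_smul, norm_smul]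
  refine (mul_le_of_le_one_left (norm_nonneg _) hinv).trans ?_
  conv_lhs => rw [← sum_repr_smul_word (bchAssoc 𝕜 p q)]
  rw [Finsupp.sum, map_sum, map_sum, mul_assoc, l1Norm, Finsupp.sum, Finset.sum_mul]
  refine (norm_sum_le _ _).trans (Finset.sum_le_sum fun w hw => ?_)
  rw [map_smul, map_smul, norm_smul]
  refine mul_le_mul_of_nonneg_left ?_ (norm_nonneg _)
  refine (norm_lift_dynkin_word_le X Y w).trans (le_of_eq ?_)
  rw [wordDeg_eq_of_mem_support (bchAssoc_mem_homPart p q) hw]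
  simp [wt, expo]

theorem summable_norm_bchPart {X Y : 𝔤} (h : ‖X‖ + ‖Y‖ < C₁) :
    Summable fun pq : ℕ × ℕ => ‖bchPart 𝕜 X Y pq.1 pq.2‖ :=
  (summable_l1Norm_bchAssoc (K := 𝕜) (norm_nonneg X) (norm_nonneg Y) h).of_nonneg_of_le
    (fun _ => norm_nonneg _) fun _ => norm_bchPart_le X Y _ _

theorem summable_norm_bchTerm {X Y : 𝔤} (h : ‖X‖ + ‖Y‖ < C₁) :
    Summable fun n : ℕ => ‖bchTerm 𝕜 X Y n‖ :=
  (((Finset.HasAntidiagonal.sigmaAntidiagonalEquivProd.summable_iff.mpr (summable_norm_bchPart h)).sigma).congr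
    fun n => by
      rw [tsum_fintype, Finset.univ_eq_attach]
      exact (Finset.sum_attach (antidiagonal n) fun pq => ‖bchPart 𝕜 X Y pq.1 pq.2‖)).of_nonneg_of_le
    (fun _ => norm_nonneg _) fun _ => norm_sum_le _ _

end Evaluation

theorem gammaLie_lt_top {x y : ℝ≥0} (h : (x : ℝ) + y < C₁) : gammaLie x y < ∞ := by
  have hs := summable_l1Norm_bchAssoc (K := ℝ) x.coe_nonneg y.coe_nonneg h
  refine lt_of_le_of_lt (ENNReal.tsum_le_tsum fun pq => ?_) hs.tsum_ofReal_lt_top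
  rw [ENNReal.ofReal_mul (mul_nonneg (l1Norm_nonneg _) (pow_nonneg x.coe_nonneg _)),
    ENNReal.ofReal_mul (l1Norm_nonneg _), ENNReal.ofReal_pow x.coe_nonneg,
    ENNReal.ofReal_pow y.coe_nonneg, ENNReal.ofReal_coe_nnreal, ENNReal.ofReal_coe_nnreal]
  gcongr
  exact gammaCoeff_le _ _

theorem summable_norm_gammaCoeff {x y : ℂ} (h : ‖x‖ + ‖y‖ < C₁) :
    Summable fun pq : ℕ × ℕ => ‖((gammaCoeff pq.1 pq.2).toReal : ℂ) * x ^ pq.1 * y ^ pq.2‖ := by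
  refine (summable_l1Norm_bchAssoc (K := ℝ) (norm_nonneg x) (norm_nonneg y) h).of_nonneg_of_le
    (fun _ => norm_nonneg _) fun pq => ?_
  rw [norm_mul, norm_mul, norm_pow, norm_pow, Complex.norm_real, Real.norm_of_nonneg
    ENNReal.toReal_nonneg]
  gcongr
  exact ENNReal.toReal_le_of_le_ofReal (l1Norm_nonneg _) (gammaCoeff_le _ _)

end
end BCH

theorem mainTheorem8 :
    -- numerical value of the constant
    (2.7014 ≤ BCH.C₁ ∧ BCH.C₁ < 2.7015) ∧
    -- absolute convergence and finiteness of the absolute BCH characteristic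
    (∀ x y : ℂ, ‖x‖ + ‖y‖ < BCH.C₁ →
      BCH.gammaLie ‖x‖₊ ‖y‖₊ < ∞ ∧
      (∀ p q : ℕ, BCH.gammaCoeff p q < ∞) ∧
      Summable fun pq : ℕ × ℕ =>
        ‖((BCH.gammaCoeff pq.1 pq.2).toReal : ℂ) * x ^ pq.1 * y ^ pq.2‖) ∧
    -- absolute convergence of the BCH series in every real or complex Banach-Lie algebra
    (∀ (𝕜 : Type*) [RCLike 𝕜],
      (∀ p q : ℕ, ∃! P : FreeLieAlgebra 𝕜 (Fin 2),
        BCH.lieToAssoc 𝕜 P = BCH.bchAssoc 𝕜 p q) ∧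
      ∀ (𝔤 : Type*) [NormedLieRing 𝔤] [NormedLieAlgebra 𝕜 𝔤] [CompleteSpace 𝔤] (X Y : 𝔤),
        ‖X‖ + ‖Y‖ < BCH.C₁ →
          (Summable fun pq : ℕ × ℕ => ‖BCH.bchPart 𝕜 X Y pq.1 pq.2‖) ∧
          Summable fun n : ℕ => ‖BCH.bchTerm 𝕜 X Y n‖) := by
  refine ⟨BCH.C₁_bounds, fun x y h => ⟨BCH.gammaLie_lt_top (by simpa using h),
    fun p q => (BCH.gammaCoeff_le p q).trans_lt ENNReal.ofReal_lt_top,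
    BCH.summable_norm_gammaCoeff h⟩, ?_⟩
  intro 𝕜 _
  exact ⟨BCH.existsUnique_lieToAssoc_eq_bchAssoc, fun 𝔤 _ _ _ X Y h =>
    ⟨BCH.summable_norm_bchPart h, BCH.summable_norm_bchTerm h⟩⟩
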